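/- Let $d\ge 1$ and let $\hat f(\omega)=\int_{\mathbb R^d} e^{-2\pi i x\cdot\omega}f(x)\,dx$. Put $\beta(0)=1$ and $\beta(p)=2^{p-1}$ for integers $p\ge 1$. For $p\ge 1$ let $J_p$ be the set of $\ell\in\{-2,-1,0,1\}^d$ with $\max_{1\le s\le d}|\ell_s+\tfrac12|>1$, and let $J_0=\{-1,0\}^d$. The boxes $$X_{p,\ell}=\prod_{s=1}^d\big[\beta(p)\ell_s,\ \beta(p)(\ell_s+1)\big),\qquad p\in\mathbb N=\{0,1,2,\dots\},\ \ell\in J_p,$$ form a dyadic partition of $\mathbb R^d$; put $I_p^\ell=X_{p,\ell}\cap\mathbb Z^d$ and $\mu I_p^\ell=\{\mu n: n\in I_p^\ell\}$. For $\varphi\in L^1(\mathbb R^d)\cap L^2(\mathbb R^d)$, $\mu,\nu>0$ and $\gamma=(p,k,\ell)$ with $p\in\mathbb N$, $k\in\mathbb Z^d$, $\ell\in J_p$, set $$\Phi^\mu_{p;\ell}(\omega)=\sum_{\eta\in\mu I_p^\ell}\hat\varphi(\omega-\eta),\qquad \varphi_\gamma(x)=\beta(p)^{-d/2}\sum_{\eta\in\mu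 I_p^\ell}e^{2\pi i\,\eta\cdot(x-k\nu/\beta(p))}\,\varphi\big(x-k\nu/\beta(p)\big),$$ and let $MD(\mu,\nu,\varphi)=\{\varphi_\gamma\}_\gamma$ be the multidimensional DOST system. **Theorem.** Let $\varphi\in L^1(\mathbb R^d)\cap L^2(\mathbb R^d)$, and suppose that $\mu>0$ is such that for some constants $a,b>0$ $$a\le\sum_{p\in\mathbb N}\sum_{\ell\in J_p}|\Phi^\mu_{p;\ell}(\omega)|^2\le b\qquad\text{for all }\omega\in\mathbb R^d.$$ Assume moreover that, for some real $N>2d$ and some constant $C$, $|\hat\varphi(\omega)|\le C(1+|\omega|)^{-N}$ for all $\omega\in\mathbb R^d$. Then there is $\nu_0>0$ such that for every $0<\nu<\nu_0$ the system $MD(\mu,\nu,\varphi)$ is a frame of $L^2(\mathbb R^d)$: there are $A,B>0$ such that for all $f\in L^2(\mathbb R^d)$ $$A\|f\|_2^2\le\sum_\gamma|\langle f,\varphi_\gamma\rangle|^2\le B\|f\|_2^2,$$ and the series $Sf=\sum_\gamma\langle f,\varphi_\gamma\rangle\varphi_\gamma$ converges unconditionally in $L^2(\mathbb R^d)$ and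 satisfies $A\|f\|_2^2\le|\langle Sf,f\rangle|\le B\|f\|_2^2$. -/

import Mathlib

open MeasureTheory
open scoped FourierTransform

namespace DOST

/-- The side `β(p)`: `β(0) = 1` and `β(p) = 2^(p-1)` for `p ≥ 1`. -/
def beta : ℕ → ℕ
  | 0 => 1
  | p + 1 => 2 ^ p

/-- The admissible multi-indices `ℓ ∈ {-2,-1,0,1}^d` at level `p`. The box of side `β(p)` with index
`ℓ` has centre `β(p) (ℓ + (1/2,…,1/2))`. For `p ≥ 1` the centre has to lie outside the inner cube
`β(p) [-1,1]^d`; for `p = 0` the unit boxes are those that fill `C_0 = [-1,1]^d`. -/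
def boxIndices (d : ℕ) : ℕ → Set (Fin d → ℤ)
  | 0 => {l | (∀ s, -2 ≤ l s ∧ l s ≤ 1) ∧ ∀ s, |(l s : ℝ) + 1 / 2| ≤ 1}
  | _ + 1 => {l | (∀ s, -2 ≤ l s ∧ l s ≤ 1) ∧ ∃ s, 1 < |(l s : ℝ) + 1 / 2|}

/-- The pairs `(p, ℓ)` with `ℓ` admissible at level `p`. -/
abbrev BoxIndex (d : ℕ) : Type := Σ p : ℕ, boxIndices d p

/-- The box `X_{p,ℓ} = ∏ₛ [β(p) ℓₛ, β(p) (ℓₛ + 1))`. -/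
def box {d : ℕ} (p : ℕ) (l : Fin d → ℤ) : Set (EuclideanSpace ℝ (Fin d)) :=
  {ω | ∀ s, (beta p : ℝ) * l s ≤ ω s ∧ ω s < (beta p : ℝ) * (l s + 1)}

/-- An integer vector as a point of `ℝ^d`. -/
noncomputable def latticePoint {d : ℕ} (n : Fin d → ℤ) : EuclideanSpace ℝ (Fin d) :=
  WithLp.toLp 2 (fun s => (n s : ℝ))

/-- `I_p^ℓ = X_{p,ℓ} ∩ ℤ^d`, as a finite set of integer vectors. -/
noncomputable def freqSet {d : ℕ} (p : ℕ) (l : Fin d → ℤ) : Finset (Fin d → ℤ) :=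
  Fintype.piFinset fun s => Finset.Ico ((beta p : ℤ) * l s) ((beta p : ℤ) * (l s + 1))

theorem mem_freqSet {d : ℕ} (p : ℕ) (l n : Fin d → ℤ) :
    n ∈ freqSet p l ↔ latticePoint n ∈ box p l := by
  simp only [freqSet, Fintype.mem_piFinset, Finset.mem_Ico, box, latticePoint, Set.mem_ofPred_eq]
  refine forall_congr' fun s => and_congr ?_ ?_
  · exact_mod_cast Iff.rfl
  · exact_mod_cast Iff.rfl

/-- `Φ^μ_{p;ℓ}(ω) = ∑_{η ∈ μ I_p^ℓ} φ̂(ω - η)`. -/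
noncomputable def Phi {d : ℕ} (φ : EuclideanSpace ℝ (Fin d) → ℂ) (μ : ℝ) (p : ℕ) (l : Fin d → ℤ)
    (ω : EuclideanSpace ℝ (Fin d)) : ℂ :=
  ∑ n ∈ freqSet p l, 𝓕 φ (ω - μ • latticePoint n)

/-- The translation parameter `k ν / β(p)`. -/
noncomputable def shift {d : ℕ} (ν : ℝ) (p : ℕ) (k : Fin d → ℤ) : EuclideanSpace ℝ (Fin d) :=
  (ν / (beta p : ℝ)) • latticePoint k

/-- `φ_γ(x) = β(p)^{-d/2} ∑_{η ∈ μ I_p^ℓ} e^{2πi η (x - kν/β(p))} φ(x - kν/β(p))`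
for `γ = (p, k, ℓ)`. -/
noncomputable def atom {d : ℕ} (φ : EuclideanSpace ℝ (Fin d) → ℂ) (μ ν : ℝ) (p : ℕ)
    (l k : Fin d → ℤ) (x : EuclideanSpace ℝ (Fin d)) : ℂ :=
  (((beta p : ℝ) ^ (-(d : ℝ) / 2) : ℝ) : ℂ) *
    ∑ n ∈ freqSet p l,
      Complex.exp (2 * Real.pi * Complex.I *
        ((inner ℝ (μ • latticePoint n) (x - shift ν p k) : ℝ) : ℂ)) * φ (x - shift ν p k)

theorem memLp_atom {d : ℕ} {φ : EuclideanSpace ℝ (Fin d) → ℂ} (hφ : MemLp φ 2 volume)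
    (μ ν : ℝ) (p : ℕ) (l k : Fin d → ℤ) : MemLp (atom φ μ ν p l k) 2 volume := by
  have h1 : MemLp (fun x => φ (x - shift ν p k)) 2 volume :=
    hφ.comp_measurePreserving (measurePreserving_sub_right volume (shift ν p k))
  have h2 : ∀ n ∈ freqSet p l, MemLp (fun x => Complex.exp (2 * Real.pi * Complex.I *
        ((inner ℝ (μ • latticePoint n) (x - shift ν p k) : ℝ) : ℂ)) * φ (x - shift ν p k))
        2 volume := by
    intro n _
    have hc : Continuous fun x : EuclideanSpace ℝ (Fin d) => Complex.exp (2 * Real.pi * Complex.I *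
        ((inner ℝ (μ • latticePoint n) (x - shift ν p k) : ℝ) : ℂ)) := by
      fun_prop
    refine MemLp.of_le h1 (hc.aestronglyMeasurable.mul h1.1) (Filter.Eventually.of_forall fun x => ?_)
    rw [norm_mul, Complex.norm_exp]
    simp
  exact (memLp_finsetSum _ h2).const_mul _

/-- The DOST system `MD(μ, ν, φ) = {φ_γ}`, as a family in `L²(ℝ^d)` indexed by
`γ = ((p, ℓ), k)`. -/
noncomputable def dostSystem {d : ℕ} {φ : EuclideanSpace ℝ (Fin d) → ℂ} (hφ : MemLp φ 2 volume)
    (μ ν : ℝ) (γ : BoxIndex d × (Fin d → ℤ)) :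
    Lp ℂ 2 (volume : Measure (EuclideanSpace ℝ (Fin d))) :=
  (memLp_atom hφ μ ν γ.1.1 γ.1.2 γ.2).toLp _

/-- The family `e` is a frame with bounds `A, B`. Mathlib's inner product is linear in the second
argument, so `inner ℂ (e i) f` is `⟨f, e i⟩ = ∫ f \bar{e i}`. -/
def IsFrameWithBounds {ι H : Type*} [NormedAddCommGroup H] [InnerProductSpace ℂ H]
    (A B : ℝ) (e : ι → H) : Prop :=
  0 < A ∧ 0 < B ∧ ∀ f : H, Summable (fun i => ‖inner ℂ (e i) f‖ ^ 2) ∧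
    A * ‖f‖ ^ 2 ≤ ∑' i, ‖inner ℂ (e i) f‖ ^ 2 ∧ ∑' i, ‖inner ℂ (e i) f‖ ^ 2 ≤ B * ‖f‖ ^ 2

end DOST

/-! On the Fourier side, the atoms of one box `(p, ℓ)` are a single function Φ multiplied by the
characters of the lattice dual to `L ℤ^d`, where `L = β(p)/ν` (`fourier_atom`). The coefficients of
`f` over `k` are therefore the Fourier coefficients of the `L`-periodization of the product of `f̂`
and the conjugate of Φ. Parseval on the torus turns their square sum into the integral of a squared
periodization. The diagonal part of that integral is `ν^(-d) ∫ |f̂|² |Φ|²`, and the rest are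
correlations of the product with its translates by `L m`, `m ≠ 0`
(`tsum_enorm_sq_integral_exp_inner_bounds`).

A Schur test (`lintegral_tsum_correlation_le`) removes the translates of `f̂`, leaving `|f̂(ω)|²`
against `∑ |Φ(ω)| |Φ(ω + L m)|` (`tsum_enorm_inner_sq_bounds`). Summed over all boxes, the diagonal
lies between `a` and `b` times `‖f‖²`, up to the common factor `ν^(-d)`.

It remains to make the total correlation smaller than `a/2`. The frequencies of one box spread over
a distance `O(β(p))`, while the translates move by at least `β(p)/ν`. For small `ν` this separation
costs half of the decay exponent `N = 2s` and gains `ν^s β(p)^(-s) |m|^(-s)`; the other half makes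
the sums over frequencies converge uniformly. Since `s > d`, the gain is summable over `m` and over
the boxes (`norm_Phi_mul_norm_Phi_add_le`, `exists_tsum_correlation_le`). Convergence of the frame
operator series needs only the upper bound. -/

open scoped ENNReal ComplexConjugate

namespace DOST

/-! ### Bessel families and the frame operator. -/

section Bessel

variable {ι H : Type*} [NormedAddCommGroup H] [InnerProductSpace ℂ H]

/-- Boundedness of the synthesis operator by duality: pair the sum `y` with itself, apply
Cauchy–Schwarz and the Bessel bound at `y`, then cancel `‖y‖²`. -/
theorem norm_sq_sum_smul_le_of_bessel {e : ι → H} {B : ℝ} (hB : 0 ≤ B)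
    (h : ∀ f : H, Summable (fun i => ‖inner ℂ (e i) f‖ ^ 2) ∧
      ∑' i, ‖inner ℂ (e i) f‖ ^ 2 ≤ B * ‖f‖ ^ 2) (c : ι → ℂ) (t : Finset ι) :
    ‖∑ i ∈ t, c i • e i‖ ^ 2 ≤ B * ∑ i ∈ t, ‖c i‖ ^ 2 := by
  set y := ∑ i ∈ t, c i • e i with hy
  have h1 : ‖y‖ ^ 2 ≤ ∑ i ∈ t, ‖c i‖ * ‖inner ℂ (e i) y‖ := by
    calc ‖y‖ ^ 2 = ‖inner ℂ y y‖ := by rw [inner_self_eq_norm_sq_to_K]; simp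
      _ = ‖∑ i ∈ t, c i * inner ℂ y (e i)‖ := by
          conv_lhs => rw [hy, inner_sum]
          simp only [inner_smul_right, ← hy]
      _ ≤ ∑ i ∈ t, ‖c i * inner ℂ y (e i)‖ := norm_sum_le _ _
      _ = _ := by simp only [norm_mul, norm_inner_symm y]
  have h2 : (∑ i ∈ t, ‖c i‖ * ‖inner ℂ (e i) y‖) ^ 2
      ≤ (∑ i ∈ t, ‖c i‖ ^ 2) * ∑ i ∈ t, ‖inner ℂ (e i) y‖ ^ 2 :=
    Finset.sum_mul_sq_le_sq_mul_sq _ _ _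
  have h3 : ∑ i ∈ t, ‖inner ℂ (e i) y‖ ^ 2 ≤ B * ‖y‖ ^ 2 :=
    ((h y).1.sum_le_tsum t fun _ _ => by positivity).trans (h y).2
  have h4 : (‖y‖ ^ 2) ^ 2 ≤ (∑ i ∈ t, ‖c i‖ ^ 2) * (B * ‖y‖ ^ 2) :=
    (pow_le_pow_left₀ (by positivity) h1 2).trans
      (h2.trans (mul_le_mul_of_nonneg_left h3 (by positivity)))
  by_cases hy0 : y = 0
  · rw [hy0]
    simp only [norm_zero, ne_eq, OfNat.ofNat_ne_zero, not_false_eq_true, zero_pow]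
    positivity
  · have : 0 < ‖y‖ ^ 2 := by positivity
    nlinarith

/-- For a Bessel family, the frame operator series converges unconditionally, and its quadratic
form is the sum of the squared coefficients. -/
theorem exists_hasSum_frameOperator [CompleteSpace H] {e : ι → H} {B : ℝ} (hB : 0 < B)
    (h : ∀ f : H, Summable (fun i => ‖inner ℂ (e i) f‖ ^ 2) ∧
      ∑' i, ‖inner ℂ (e i) f‖ ^ 2 ≤ B * ‖f‖ ^ 2) (f : H) :
    ∃ Sf : H, HasSum (fun i => inner ℂ (e i) f • e i) Sf ∧
      inner ℂ f Sf = ((∑' i, ‖inner ℂ (e i) f‖ ^ 2 : ℝ) : ℂ) := by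
  have hsum : Summable (fun i => inner ℂ (e i) f • e i) := by
    rw [summable_iff_vanishing_norm]
    intro ε hε
    -- The synthesis bound turns a coefficient tail below `ε²/B` into a vector tail of norm below
    -- `ε`.
    obtain ⟨s, hs⟩ := (summable_iff_vanishing_norm.mp (h f).1) (ε ^ 2 / B) (by positivity)
    refine ⟨s, fun t ht => ?_⟩
    have h1 := hs t ht
    rw [Real.norm_of_nonneg (Finset.sum_nonneg fun _ _ => by positivity), lt_div_iff₀ hB] at h1
    have h2 := norm_sq_sum_smul_le_of_bessel hB.le h (fun i => inner ℂ (e i) f) t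
    exact lt_of_pow_lt_pow_left₀ 2 hε.le (by linarith)
  refine ⟨_, hsum.hasSum, ?_⟩
  have h1 : HasSum (fun i => inner ℂ f (inner ℂ (e i) f • e i))
      (inner ℂ f (∑' i, inner ℂ (e i) f • e i)) := by
    simpa using hsum.hasSum.mapL (innerSL ℂ f)
  have h2 : (fun i => inner ℂ f (inner ℂ (e i) f • e i))
      = fun i => ((‖inner ℂ (e i) f‖ ^ 2 : ℝ) : ℂ) := by
    funext i
    rw [inner_smul_right, ← inner_conj_symm f (e i), Complex.mul_conj, Complex.normSq_eq_norm_sq]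
  rw [h2] at h1
  exact h1.unique (Complex.hasSum_ofReal.mpr (h f).1.hasSum)

end Bessel

/-! ### Diagonal and off-diagonal parts of a squared sum. -/

section Sequences

variable {M : Type*} [AddCommGroup M] [DecidableEq M]

/-- The square of an absolutely convergent sum differs from the sum of the squares by at most the
off-diagonal terms. -/
theorem enorm_tsum_sq_bounds {a : M → ℂ} (ha : Summable fun m => ‖a m‖) :
    ‖∑' m, a m‖ₑ ^ 2 ≤ ∑' m, ‖a m‖ₑ ^ 2 +
        ∑' m, ∑' n, (if n = 0 then 0 else ‖a m‖ₑ * ‖a (m + n)‖ₑ) ∧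
    ∑' m, ‖a m‖ₑ ^ 2 ≤ ‖∑' m, a m‖ₑ ^ 2 +
        ∑' m, ∑' n, (if n = 0 then 0 else ‖a m‖ₑ * ‖a (m + n)‖ₑ) := by
  have hs : Summable a := ha.of_norm
  set S := ∑' m, a m with hS
  -- Summed over `m`, these terms give exactly `|S|² - ∑ |a m|²`.
  set r : M → ℂ := fun m => a m * conj (S - a m) with hr
  have hrest : ∀ m, ‖S - a m‖ₑ ≤ ∑' n, if n = 0 then 0 else ‖a (m + n)‖ₑ := by
    intro m
    have h1 : S = a m + ∑' n, if n = 0 then 0 else a (m + n) := by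
      have h2 : Summable fun n => a (m + n) := (Equiv.addLeft m).summable_iff.mpr hs
      have h3 := h2.tsum_eq_add_tsum_ite 0
      rw [add_zero] at h3
      rw [← h3]
      exact ((Equiv.addLeft m).tsum_eq a).symm
    rw [h1, add_sub_cancel_left]
    refine (enorm_tsum_le_tsum_enorm).trans (ENNReal.tsum_le_tsum fun n => ?_)
    split_ifs <;> simp
  have hrb : ∀ m, ‖r m‖ₑ ≤ ∑' n, if n = 0 then 0 else ‖a m‖ₑ * ‖a (m + n)‖ₑ := by
    intro m
    rw [hr]
    simp only [enorm_mul, RCLike.enorm_conj]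
    refine (mul_le_mul_right (hrest m) _).trans ?_
    rw [← ENNReal.tsum_mul_left]
    simp
  have hsq : Summable fun m => ‖a m‖ ^ 2 := by
    simpa only [sq, Function.comp_def] using
      (ha.mul_of_nonneg ha (fun _ => norm_nonneg _) fun _ => norm_nonneg _).comp_injective
        (i := fun m : M => (m, m)) fun _ _ h => (Prod.mk.inj h).1
  have h1 : HasSum (fun m => ((‖a m‖ ^ 2 : ℝ) : ℂ)) ((∑' m, ‖a m‖ ^ 2 : ℝ) : ℂ) :=
    Complex.hasSum_ofReal.mpr hsq.hasSum
  have h2 : HasSum (fun m => a m * conj S) (S * conj S) := hs.hasSum.mul_right _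
  have h3 : HasSum r (S * conj S - ((∑' m, ‖a m‖ ^ 2 : ℝ) : ℂ)) := by
    refine (h2.sub h1).congr_fun fun m => ?_
    simp only [hr]
    rw [← Complex.normSq_eq_norm_sq, ← Complex.mul_conj, map_sub]
    ring
  have h4 : ‖S * conj S - ((∑' m, ‖a m‖ ^ 2 : ℝ) : ℂ)‖ₑ
      ≤ ∑' m, ∑' n, (if n = 0 then 0 else ‖a m‖ₑ * ‖a (m + n)‖ₑ) := by
    rw [← h3.tsum_eq]
    exact (enorm_tsum_le_tsum_enorm).trans (ENNReal.tsum_le_tsum hrb)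
  have h5 : ‖((∑' m, ‖a m‖ ^ 2 : ℝ) : ℂ)‖ₑ = ∑' m, ‖a m‖ₑ ^ 2 := by
    rw [← ofReal_norm, Complex.norm_real, Real.norm_of_nonneg (tsum_nonneg fun _ => by positivity),
      ENNReal.ofReal_tsum_of_nonneg (fun _ => by positivity) hsq]
    exact tsum_congr fun m => by rw [ENNReal.ofReal_pow (norm_nonneg _), ofReal_norm]
  have h6 : ‖S * conj S‖ₑ = ‖S‖ₑ ^ 2 := by rw [enorm_mul, RCLike.enorm_conj, sq]
  rw [← h5, ← h6]
  constructor
  · refine le_trans ?_ (add_le_add_right h4 _)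
    refine le_trans (le_of_eq ?_) (enorm_add_le _ _)
    rw [add_sub_cancel]
  · refine le_trans ?_ (add_le_add_right h4 _)
    refine le_trans (le_of_eq ?_) (enorm_sub_le)
    rw [sub_sub_cancel]

end Sequences

/-! ### Schur test for correlations under translation. -/

section Schur

variable {E M : Type*} [MeasurableSpace E] [AddCommGroup E] [MeasurableAdd E]
  [AddCommGroup M] [DecidableEq M] [Countable M] {ρ : Measure E} [ρ.IsAddRightInvariant]

theorem ennreal_two_mul_mul_le (x y : ℝ≥0∞) : 2 * (x * y) ≤ x ^ 2 + y ^ 2 := by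
  rcases eq_or_ne x ⊤ with rfl | hx
  · simp
  rcases eq_or_ne y ⊤ with rfl | hy
  · simp
  lift x to NNReal using hx
  lift y to NNReal using hy
  rw [← mul_assoc]
  exact_mod_cast two_mul_le_add_sq x y

/-- A Schur test for the correlations of `h * ψ` along translations by `v m`, `m ≠ 0`. -/
theorem lintegral_tsum_correlation_le {h ψ : E → ℝ≥0∞} (hh : Measurable h) (hψ : Measurable ψ)
    (v : M →+ E) :
    ∫⁻ x, ∑' m, (if m = 0 then 0 else (h x * ψ x) * (h (x + v m) * ψ (x + v m))) ∂ρ ≤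
      ∫⁻ x, h x ^ 2 * ∑' m, (if m = 0 then 0 else ψ x * ψ (x + v m)) ∂ρ := by
  have hT : ∀ m, Measurable fun x => x + v m := fun m => measurable_add_const _
  have key : ∀ m, 2 * ∫⁻ x, (h x * ψ x) * (h (x + v m) * ψ (x + v m)) ∂ρ ≤
      ∫⁻ x, h x ^ 2 * (ψ x * ψ (x + v m)) ∂ρ + ∫⁻ x, h x ^ 2 * (ψ x * ψ (x + v (-m))) ∂ρ := by
    intro m
    -- Translation by `v m` converts the weight at `x + v m` into the term of index `-m` with weight
    -- at `x`.
    have h1 : ∫⁻ x, h x ^ 2 * (ψ x * ψ (x + v (-m))) ∂ρ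
        = ∫⁻ x, h (x + v m) ^ 2 * (ψ (x + v m) * ψ x) ∂ρ := by
      rw [← lintegral_add_right_eq_self _ (v m)]
      simp
    rw [h1, ← lintegral_const_mul _ (by fun_prop), ← lintegral_add_left (by fun_prop)]
    refine lintegral_mono fun x => ?_
    calc _ = 2 * (h x * h (x + v m)) * (ψ x * ψ (x + v m)) := by ring
      _ ≤ (h x ^ 2 + h (x + v m) ^ 2) * (ψ x * ψ (x + v m)) := by
          gcongr; exact ennreal_two_mul_mul_le _ _
      _ = _ := by ring
  have e1 : ∀ x, h x ^ 2 * ∑' m, (if m = 0 then 0 else ψ x * ψ (x + v m))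
      = ∑' m, if m = 0 then 0 else h x ^ 2 * (ψ x * ψ (x + v m)) := by
    intro x
    rw [← ENNReal.tsum_mul_left]
    simp
  have e2 : ∀ g : M → E → ℝ≥0∞, (∀ m, Measurable (g m)) →
      ∫⁻ x, ∑' m, (if m = 0 then 0 else g m x) ∂ρ = ∑' m, if m = 0 then 0 else ∫⁻ x, g m x ∂ρ := by
    intro g hg
    rw [lintegral_tsum]
    · refine tsum_congr fun m => ?_
      split_ifs <;> simp
    · intro m
      split_ifs
      · exact aemeasurable_const
      · exact (hg m).aemeasurable
  simp_rw [e1]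
  rw [e2 (fun m x => (h x * ψ x) * (h (x + v m) * ψ (x + v m))) (fun m => by fun_prop),
    e2 (fun m x => h x ^ 2 * (ψ x * ψ (x + v m))) (fun m => by fun_prop)]
  set s : M → ℝ≥0∞ := fun m => if m = 0 then 0 else ∫⁻ x, h x ^ 2 * (ψ x * ψ (x + v m)) ∂ρ with hs
  have h2 : 2 * ∑' m, (if m = 0 then 0 else
      ∫⁻ x, (h x * ψ x) * (h (x + v m) * ψ (x + v m)) ∂ρ) ≤ 2 * ∑' m, s m := by
    -- The index set is symmetric, so the two halves produced by the arithmetic-geometric inequality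
    -- have equal sums.
    have h3 : ∑' m, s (-m) = ∑' m, s m := (Equiv.neg M).tsum_eq s
    rw [two_mul (∑' m, s m)]
    conv_rhs => rw [← h3]
    rw [h3, ← ENNReal.tsum_mul_left]
    conv_rhs => enter [2]; rw [← h3]
    rw [← ENNReal.tsum_add]
    refine ENNReal.tsum_le_tsum fun m => ?_
    by_cases hm : m = 0
    · simp [hm]
    · simp only [hs, hm, if_false, neg_eq_zero]
      exact key m
  exact (ENNReal.mul_le_mul_iff_right (by simp) (by simp)).mp h2

end Schur

/-! ### Periodization over the integer lattice. -/

section Periodization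

variable {d : ℕ}

/-- The half-open unit cube `(0, 1]^d`. -/
def unitCube (d : ℕ) : Set (Fin d → ℝ) := {x | ∀ i, x i ∈ Set.Ioc (0 : ℝ) (0 + 1)}

/-- An integer vector as an element of `Fin d → ℝ`. -/
def intVec : (Fin d → ℤ) →+ (Fin d → ℝ) where
  toFun m i := m i
  map_zero' := by ext; simp
  map_add' := by intros; ext; simp

theorem measurableSet_unitCube : MeasurableSet (unitCube d) :=
  MeasurableSet.univ_pi' fun _ => measurableSet_Ioc

/-- Lebesgue measure is the sum of the translates of its restriction to the unit cube. -/
theorem volume_eq_sum_map_unitCube : (volume : Measure (Fin d → ℝ)) =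
    Measure.sum fun m : Fin d → ℤ => (volume.restrict (unitCube d)).map (· + intVec m) := by
  have h1 : ∀ m : Fin d → ℤ, (volume.restrict (unitCube d)).map (· + intVec m)
      = volume.restrict ((· - intVec m) ⁻¹' unitCube d) := by
    intro m
    have h2 := (measurePreserving_add_right (volume : Measure (Fin d → ℝ))
      (intVec m)).restrict_preimage
      (s := (· - intVec m) ⁻¹' unitCube d) (measurable_sub_const _ measurableSet_unitCube)
    rw [← Set.preimage_comp] at h2
    have h3 : ((· - intVec m) ∘ (· + intVec m) : (Fin d → ℝ) → (Fin d → ℝ)) = id := by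
      ext x; simp
    rw [h3] at h2
    exact h2.map_eq
  simp_rw [h1]
  rw [← Measure.restrict_iUnion]
  · rw [Set.iUnion_eq_univ_iff.mpr, Measure.restrict_univ]
    intro x
    -- The cube is open on the left and closed on the right, hence the ceiling minus one rather than
    -- the floor.
    refine ⟨fun i => ⌈x i⌉ - 1, fun i => ?_⟩
    simp only [intVec, AddMonoidHom.coe_mk, ZeroHom.coe_mk, Pi.sub_apply, Set.mem_Ioc]
    push_cast
    constructor <;> linarith [Int.ceil_lt_add_one (x i), Int.le_ceil (x i)]
  · intro m n hmn
    rw [Function.onFun, Set.disjoint_left]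
    intro x hx hy
    apply hmn
    ext i
    have h2 := hx i
    have h3 := hy i
    simp only [intVec, AddMonoidHom.coe_mk, ZeroHom.coe_mk, Pi.sub_apply, Set.mem_Ioc] at h2 h3
    have h4 : (m i : ℝ) < n i + 1 := by linarith
    have h5 : (n i : ℝ) < m i + 1 := by linarith
    norm_cast at h4 h5
    omega
  · exact fun m => measurable_sub_const _ measurableSet_unitCube

theorem lintegral_eq_lintegral_unitCube_tsum {g : (Fin d → ℝ) → ℝ≥0∞} (hg : Measurable g) :
    ∫⁻ x, g x = ∫⁻ x in unitCube d, ∑' m : Fin d → ℤ, g (x + intVec m) := by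
  rw [lintegral_tsum fun m => by fun_prop]
  conv_lhs => rw [volume_eq_sum_map_unitCube]
  rw [lintegral_sum_measure]
  exact tsum_congr fun m => lintegral_map hg (by fun_prop)

theorem ae_summable_norm_periodization {g : (Fin d → ℝ) → ℂ} (hm : Measurable g)
    (hg : Integrable g) :
    ∀ᵐ x ∂(volume.restrict (unitCube d)), Summable fun m : Fin d → ℤ => ‖g (x + intVec m)‖ := by
  have h1 := lintegral_eq_lintegral_unitCube_tsum (g := fun x => ‖g x‖ₑ) hm.enorm
  have h2 : ∫⁻ x in unitCube d, ∑' m : Fin d → ℤ, ‖g (x + intVec m)‖ₑ ≠ ⊤ := by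
    rw [← h1]
    exact hg.2.ne
  have h3 := ae_lt_top' (Measurable.aemeasurable (by fun_prop)) h2
  filter_upwards [h3] with x hx
  have := ENNReal.summable_toReal hx.ne
  simpa using this

theorem integral_eq_integral_unitCube_tsum {g : (Fin d → ℝ) → ℂ} (hm : Measurable g)
    (hg : Integrable g) :
    ∫ x, g x = ∫ x in unitCube d, ∑' m : Fin d → ℤ, g (x + intVec m) := by
  have hm' : ∀ m : Fin d → ℤ, AEStronglyMeasurable (fun x => g (x + intVec m))
      (volume.restrict (unitCube d)) :=
    fun m => (hm.comp (measurable_add_const _)).aestronglyMeasurable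
  rw [integral_tsum hm']
  · conv_lhs => rw [volume_eq_sum_map_unitCube]
    rw [integral_sum_measure (by rw [← volume_eq_sum_map_unitCube]; exact hg)]
    exact tsum_congr fun m => integral_map (by fun_prop) (by fun_prop)
  · rw [← lintegral_tsum (fun m => by fun_prop), ← lintegral_eq_lintegral_unitCube_tsum hm.enorm]
    exact hg.2.ne

theorem aestronglyMeasurable_periodization {g : (Fin d → ℝ) → ℂ} (hm : Measurable g)
    (hg : Integrable g) :
    AEStronglyMeasurable (fun x => ∑' m : Fin d → ℤ, g (x + intVec m))
      (volume.restrict (unitCube d)) := by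
  refine aestronglyMeasurable_of_tendsto_ae Filter.atTop
    (f := fun (s : Finset (Fin d → ℤ)) x => ∑ m ∈ s, g (x + intVec m)) (fun s => ?_) ?_
  · exact (Finset.measurable_fun_sum s
      fun m _ => hm.comp (measurable_add_const _)).aestronglyMeasurable
  · filter_upwards [ae_summable_norm_periodization hm hg] with x hx
    exact hx.of_norm.hasSum

end Periodization

/-! ### Parseval's identity on the torus. -/

section Torus

-- Within this section the volume on the circle is the normalised Haar measure.
noncomputable local instance unitAddCircleMeasureSpace : MeasureSpace UnitAddCircle :=
  ⟨AddCircle.haarAddCircle⟩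

local instance : IsProbabilityMeasure (volume : Measure UnitAddCircle) :=
  inferInstanceAs (IsProbabilityMeasure AddCircle.haarAddCircle)

variable {d : ℕ}

theorem tsum_enorm_sq_mFourierCoeff {p : UnitAddTorus (Fin d) → ℂ} (hp : MemLp p 2 volume) :
    ∑' k, ‖UnitAddTorus.mFourierCoeff p k‖ₑ ^ 2 = ∫⁻ t, ‖p t‖ₑ ^ 2 := by
  have h1 := UnitAddTorus.hasSum_sq_mFourierCoeff (hp.toLp p)
  have h2 : ∀ k, UnitAddTorus.mFourierCoeff (hp.toLp p) k = UnitAddTorus.mFourierCoeff p k :=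
    fun k => integral_congr_ae (by
      filter_upwards [hp.coeFn_toLp] with t ht
      rw [ht])
  have h3 : ∫ t, ‖hp.toLp p t‖ ^ 2 = ∫ t, ‖p t‖ ^ 2 := integral_congr_ae (by
      filter_upwards [hp.coeFn_toLp] with t ht
      rw [ht])
  simp_rw [h2, h3] at h1
  have h4 : ∫⁻ t, ‖p t‖ₑ ^ 2 = ENNReal.ofReal (∫ t, ‖p t‖ ^ 2) := by
    rw [ofReal_integral_eq_lintegral_ofReal ((memLp_two_iff_integrable_sq_norm hp.1).mp hp)
      (Filter.Eventually.of_forall fun t => by positivity)]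
    exact lintegral_congr fun t => by rw [ENNReal.ofReal_pow (norm_nonneg _), ofReal_norm]
  rw [h4, ← h1.tsum_eq, ENNReal.ofReal_tsum_of_nonneg (fun _ => by positivity) h1.summable]
  exact tsum_congr fun m => by rw [ENNReal.ofReal_pow (norm_nonneg _), ofReal_norm]

/-- Parseval's identity for the periodization of an integrable function. -/
theorem tsum_enorm_sq_integral_exp {g : (Fin d → ℝ) → ℂ} (hm : Measurable g)
    (hg : Integrable g)
    (h2 : ∫⁻ x in unitCube d, ‖∑' m : Fin d → ℤ, g (x + intVec m)‖ₑ ^ 2 ≠ ⊤) :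
    ∑' k : Fin d → ℤ,
        ‖∫ x, Complex.exp (2 * Real.pi * Complex.I * ((∑ i, (k i : ℝ) * x i : ℝ) : ℂ)) * g x‖ₑ ^ 2
      = ∫⁻ x in unitCube d, ‖∑' m : Fin d → ℤ, g (x + intVec m)‖ₑ ^ 2 := by
  set P : (Fin d → ℝ) → ℂ := fun x => ∑' m : Fin d → ℤ, g (x + intVec m) with hP
  set p : UnitAddTorus (Fin d) → ℂ := fun t => P (UnitAddTorus.measurableEquivPiIoc 0 t).1 with hp
  have hpP : ∀ x ∈ unitCube d, p (fun i => (x i : UnitAddCircle)) = P x := by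
    intro x hx
    have := (UnitAddTorus.measurableEquivPiIoc (0 : Fin d → ℝ)).apply_symm_apply ⟨x, hx⟩
    rw [UnitAddTorus.coe_symm_measurableEquivPiIoc_apply] at this
    rw [hp]
    simp only [this]
  have hcoe : MeasurePreserving (fun t => (UnitAddTorus.measurableEquivPiIoc (0 : Fin d → ℝ) t).1)
      volume (volume.restrict (unitCube d)) :=
    (measurePreserving_subtype_coe measurableSet_unitCube).comp
      (UnitAddTorus.measurePreserving_equivPiIoc (0 : Fin d → ℝ))
  have hpm : AEStronglyMeasurable p volume :=
    (aestronglyMeasurable_periodization hm hg).comp_measurePreserving hcoe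
  have hnorm : ∫⁻ t, ‖p t‖ₑ ^ 2 = ∫⁻ x in unitCube d, ‖P x‖ₑ ^ 2 := by
    rw [UnitAddTorus.lintegral_preimage _ 0]
    exact setLIntegral_congr_fun measurableSet_unitCube fun x hx => by
      simp only [hpP x hx]
  have hp2 : MemLp p 2 volume := by
    refine ⟨hpm, ?_⟩
    rw [eLpNorm_lt_top_iff_lintegral_rpow_enorm_lt_top (by simp) (by simp)]
    simpa [hnorm] using h2.lt_top
  -- The sign of `k` is flipped because `mFourierCoeff` integrates against `mFourier (-k)`.
  rw [← hnorm, ← tsum_enorm_sq_mFourierCoeff hp2, ← (Equiv.neg (Fin d → ℤ)).tsum_eq]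
  refine tsum_congr fun k => ?_
  congr 2
  have hexp : ∀ x : Fin d → ℝ, UnitAddTorus.mFourier (-k) (fun i => (x i : UnitAddCircle))
      = Complex.exp (2 * Real.pi * Complex.I * ((∑ i, ((-k) i : ℝ) * x i : ℝ) : ℂ)) := by
    intro x
    simp only [UnitAddTorus.mFourier, ContinuousMap.coe_mk, fourier_coe_apply]
    rw [← Complex.exp_sum]
    congr 1
    push_cast
    rw [Finset.mul_sum]
    exact Finset.sum_congr rfl fun i _ => by simp; ring
  have hexpm : ∀ (x : Fin d → ℝ) (m : Fin d → ℤ),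
      UnitAddTorus.mFourier (-k) (fun i => ((x + intVec m) i : UnitAddCircle))
      = UnitAddTorus.mFourier (-k) (fun i => (x i : UnitAddCircle)) := by
    intro x m
    congr 1
    ext i
    simp [intVec]
  have hmeas : Measurable fun x : Fin d → ℝ =>
      Complex.exp (2 * Real.pi * Complex.I * ((∑ i, ((-k) i : ℝ) * x i : ℝ) : ℂ)) := by
    fun_prop
  have hnorm1 : ∀ x : Fin d → ℝ,
      ‖Complex.exp (2 * Real.pi * Complex.I * ((∑ i, ((-k) i : ℝ) * x i : ℝ) : ℂ))‖ ≤ 1 := by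
    intro x
    rw [Complex.norm_exp]
    simp
  rw [UnitAddTorus.mFourierCoeff_eq_integral _ _ 0]
  have hint := hg.bdd_mul hmeas.aestronglyMeasurable (Filter.Eventually.of_forall hnorm1)
  have h3 := integral_eq_integral_unitCube_tsum (hmeas.mul hm) hint
  refine Eq.trans ?_ (h3.trans ?_)
  · simp
  · refine setIntegral_congr_fun measurableSet_unitCube fun x hx => ?_
    simp only [smul_eq_mul, Pi.mul_apply]
    rw [hpP x hx, hP, ← tsum_mul_left]
    exact tsum_congr fun m => by rw [← hexp, hexpm]

end Torus

/-! ### Parseval with an off-diagonal error. -/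

section Correlation

variable {d : ℕ}

/-- The periodization bounds: up to the off-diagonal correlations, the Fourier coefficients of an
integrable function at integer frequencies carry its `L²` norm. -/
theorem tsum_enorm_sq_integral_exp_bounds {g : (Fin d → ℝ) → ℂ} (hm : Measurable g)
    (hg : Integrable g) (hg2 : ∫⁻ x, ‖g x‖ₑ ^ 2 ≠ ⊤)
    (hcor : ∫⁻ x, ∑' n : Fin d → ℤ, (if n = 0 then 0 else ‖g x‖ₑ * ‖g (x + intVec n)‖ₑ) ≠ ⊤) :
    ∑' k : Fin d → ℤ,
        ‖∫ x, Complex.exp (2 * Real.pi * Complex.I * ((∑ i, (k i : ℝ) * x i : ℝ) : ℂ)) * g x‖ₑ ^ 2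
      ≤ (∫⁻ x, ‖g x‖ₑ ^ 2) +
        ∫⁻ x, ∑' n : Fin d → ℤ, (if n = 0 then 0 else ‖g x‖ₑ * ‖g (x + intVec n)‖ₑ) ∧
    ∫⁻ x, ‖g x‖ₑ ^ 2 ≤ ∑' k : Fin d → ℤ,
        ‖∫ x, Complex.exp (2 * Real.pi * Complex.I * ((∑ i, (k i : ℝ) * x i : ℝ) : ℂ)) * g x‖ₑ ^ 2 +
        ∫⁻ x, ∑' n : Fin d → ℤ, (if n = 0 then 0 else ‖g x‖ₑ * ‖g (x + intVec n)‖ₑ) := by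
  have hmt : ∀ n : Fin d → ℤ, Measurable fun x =>
      if n = 0 then 0 else ‖g x‖ₑ * ‖g (x + intVec n)‖ₑ := by
    intro n
    split_ifs
    · exact measurable_const
    · exact hm.enorm.mul (hm.comp (measurable_add_const _)).enorm
  have hmc : Measurable fun x =>
      ∑' n : Fin d → ℤ, (if n = 0 then 0 else ‖g x‖ₑ * ‖g (x + intVec n)‖ₑ) :=
    Measurable.tsum hmt
  have hms : Measurable fun x => ∑' m : Fin d → ℤ, ‖g (x + intVec m)‖ₑ ^ 2 :=
    Measurable.tsum fun m => (hm.comp (measurable_add_const _)).enorm.pow_const 2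
  have e1 := lintegral_eq_lintegral_unitCube_tsum (g := fun x => ‖g x‖ₑ ^ 2) (hm.enorm.pow_const 2)
  have e2 := lintegral_eq_lintegral_unitCube_tsum hmc
  simp only [add_assoc, ← map_add] at e2
  have hb : ∀ᵐ x ∂(volume.restrict (unitCube d)), _ :=
    (ae_summable_norm_periodization hm hg).mono fun x hx => enorm_tsum_sq_bounds hx
  have h1 : ∫⁻ x in unitCube d, ‖∑' m : Fin d → ℤ, g (x + intVec m)‖ₑ ^ 2 ≤ (∫⁻ x, ‖g x‖ₑ ^ 2) +
      ∫⁻ x, ∑' n : Fin d → ℤ, (if n = 0 then 0 else ‖g x‖ₑ * ‖g (x + intVec n)‖ₑ) := by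
    rw [e1, e2, ← lintegral_add_left hms]
    exact lintegral_mono_ae (hb.mono fun x hx => hx.1)
  have h2 : ∫⁻ x, ‖g x‖ₑ ^ 2 ≤ (∫⁻ x in unitCube d, ‖∑' m : Fin d → ℤ, g (x + intVec m)‖ₑ ^ 2) +
      ∫⁻ x, ∑' n : Fin d → ℤ, (if n = 0 then 0 else ‖g x‖ₑ * ‖g (x + intVec n)‖ₑ) := by
    rw [e1, e2,
      ← lintegral_add_left' ((aestronglyMeasurable_periodization hm hg).enorm.pow_const 2)]
    exact lintegral_mono_ae (hb.mono fun x hx => hx.2)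
  -- The upper bound `h1` shows that the periodization is square integrable, as Parseval requires.
  rw [tsum_enorm_sq_integral_exp hm hg
    (ne_top_of_le_ne_top (ENNReal.add_ne_top.mpr ⟨hg2, hcor⟩) h1)]
  exact ⟨h1, h2⟩

end Correlation

/-! ### Passage from the unit lattice to scale `L`. -/

section Scaling

variable {d : ℕ}

theorem inner_latticePoint (k : Fin d → ℤ) (x : EuclideanSpace ℝ (Fin d)) :
    inner ℝ (latticePoint k) x = ∑ i, (k i : ℝ) * x i := by
  simp [latticePoint, PiLp.inner_apply, mul_comm]

/-- The dilation `x ↦ L x` as a map from `Fin d → ℝ` to Euclidean space. -/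
noncomputable def dilation (L : ℝ) (x : Fin d → ℝ) : EuclideanSpace ℝ (Fin d) :=
  L • WithLp.toLp 2 x

theorem measurable_dilation (L : ℝ) : Measurable (dilation L : (Fin d → ℝ) → _) :=
  (WithLp.measurable_toLp 2 _).const_smul L

theorem map_dilation_volume {L : ℝ} (hL : 0 < L) :
    Measure.map (dilation L : (Fin d → ℝ) → _) volume = ENNReal.ofReal (L ^ d)⁻¹ • volume := by
  have h1 : (dilation L : (Fin d → ℝ) → _) = (fun y => L • y) ∘ WithLp.toLp 2 := rfl
  rw [h1, ← Measure.map_map (measurable_const_smul L) (WithLp.measurable_toLp 2 _),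
    (PiLp.volume_preserving_toLp (Fin d)).map_eq, Measure.map_addHaar_smul volume hL.ne']
  rw [finrank_euclideanSpace_fin, abs_of_pos (by positivity)]

theorem dilation_add_intVec (L : ℝ) (x : Fin d → ℝ) (n : Fin d → ℤ) :
    dilation L (x + intVec n) = dilation L x + L • latticePoint n := by
  rw [dilation, WithLp.toLp_add, smul_add]
  rfl

theorem lintegral_comp_dilation {L : ℝ} (hL : 0 < L) {H : EuclideanSpace ℝ (Fin d) → ℝ≥0∞}
    (hH : Measurable H) :
    ∫⁻ x, H (dilation L x) = ENNReal.ofReal (L ^ d)⁻¹ * ∫⁻ ω, H ω := by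
  rw [← lintegral_map hH (measurable_dilation L), map_dilation_volume hL, lintegral_smul_measure,
    smul_eq_mul]

theorem integral_comp_dilation {L : ℝ} (hL : 0 < L) {H : EuclideanSpace ℝ (Fin d) → ℂ}
    (hH : Measurable H) :
    ∫ x, H (dilation L x) = ((L ^ d)⁻¹ : ℝ) • ∫ ω, H ω := by
  rw [← integral_map (measurable_dilation L).aemeasurable hH.aestronglyMeasurable,
    map_dilation_volume hL, integral_smul_measure, ENNReal.toReal_ofReal (by positivity)]

/-- The periodization bounds at scale `L`. -/
theorem tsum_enorm_sq_integral_exp_inner_bounds {L : ℝ} (hL : 0 < L)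
    {F : EuclideanSpace ℝ (Fin d) → ℂ} (hm : Measurable F)
    (hF : Integrable F) (hF2 : ∫⁻ ω, ‖F ω‖ₑ ^ 2 ≠ ⊤)
    (hcor : ∫⁻ ω, ∑' n : Fin d → ℤ,
      (if n = 0 then 0 else ‖F ω‖ₑ * ‖F (ω + L • latticePoint n)‖ₑ) ≠ ⊤) :
    ∑' k : Fin d → ℤ, ‖∫ ω, Complex.exp (2 * Real.pi * Complex.I *
          ((inner ℝ (L⁻¹ • latticePoint k) ω : ℝ) : ℂ)) * F ω‖ₑ ^ 2
      ≤ ENNReal.ofReal (L ^ d) * ((∫⁻ ω, ‖F ω‖ₑ ^ 2) + ∫⁻ ω, ∑' n : Fin d → ℤ,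
          (if n = 0 then 0 else ‖F ω‖ₑ * ‖F (ω + L • latticePoint n)‖ₑ)) ∧
    ENNReal.ofReal (L ^ d) * ∫⁻ ω, ‖F ω‖ₑ ^ 2 ≤
      ∑' k : Fin d → ℤ, ‖∫ ω, Complex.exp (2 * Real.pi * Complex.I *
          ((inner ℝ (L⁻¹ • latticePoint k) ω : ℝ) : ℂ)) * F ω‖ₑ ^ 2
      + ENNReal.ofReal (L ^ d) * ∫⁻ ω, ∑' n : Fin d → ℤ,
          (if n = 0 then 0 else ‖F ω‖ₑ * ‖F (ω + L • latticePoint n)‖ₑ) := by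
  have hmt : ∀ n : Fin d → ℤ, Measurable fun ω =>
      if n = 0 then 0 else ‖F ω‖ₑ * ‖F (ω + L • latticePoint n)‖ₑ := by
    intro n
    split_ifs
    · exact measurable_const
    · exact hm.enorm.mul (hm.comp (measurable_add_const _)).enorm
  set cor := ∫⁻ ω, ∑' n : Fin d → ℤ,
      (if n = 0 then 0 else ‖F ω‖ₑ * ‖F (ω + L • latticePoint n)‖ₑ) with hcord
  set κ : ℝ := (L ^ d)⁻¹ with hκ
  have hκ0 : 0 < κ := by positivity
  have hc2 : ∫⁻ x, ∑' n : Fin d → ℤ, (if n = 0 then 0 else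
      ‖F (dilation L x)‖ₑ * ‖F (dilation L (x + intVec n))‖ₑ) = ENNReal.ofReal κ * cor := by
    simp_rw [dilation_add_intVec]
    exact lintegral_comp_dilation hL (Measurable.tsum hmt)
  have hn2 : ∫⁻ x, ‖F (dilation L x)‖ₑ ^ 2 = ENNReal.ofReal κ * ∫⁻ ω, ‖F ω‖ₑ ^ 2 :=
    lintegral_comp_dilation hL (hm.enorm.pow_const 2)
  have hint : Integrable (fun x => F (dilation L x)) := by
    have h1 : Integrable F (Measure.map (dilation L) volume) := by
      rw [map_dilation_volume hL]
      exact hF.smul_measure (by simp)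
    exact h1.comp_measurable (measurable_dilation L)
  have hcoef : ∀ k : Fin d → ℤ, ‖∫ x, Complex.exp (2 * Real.pi * Complex.I *
      ((∑ i, (k i : ℝ) * x i : ℝ) : ℂ)) * F (dilation L x)‖ₑ ^ 2 = ENNReal.ofReal κ ^ 2 *
      ‖∫ ω, Complex.exp (2 * Real.pi * Complex.I *
          ((inner ℝ (L⁻¹ • latticePoint k) ω : ℝ) : ℂ)) * F ω‖ₑ ^ 2 := by
    intro k
    have h1 := integral_comp_dilation hL (H := fun ω => Complex.exp (2 * Real.pi * Complex.I *
          ((inner ℝ (L⁻¹ • latticePoint k) ω : ℝ) : ℂ)) * F ω)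
          (Measurable.mul (Continuous.measurable (by fun_prop)) hm)
    have h2 : ∀ x : Fin d → ℝ, inner ℝ (L⁻¹ • latticePoint k) (dilation L x)
        = ∑ i, (k i : ℝ) * x i := by
      intro x
      rw [dilation, inner_smul_left, inner_smul_right, inner_latticePoint]
      simp [hL.ne']
    simp_rw [h2] at h1
    rw [h1, enorm_smul, mul_pow, Real.enorm_of_nonneg hκ0.le]
  have hb := tsum_enorm_sq_integral_exp_bounds (hm.comp (measurable_dilation L)) hint
    (by
      simp only [Function.comp_apply]
      rw [hn2]
      exact ENNReal.mul_ne_top (by simp) hF2)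
    (by
      simp only [Function.comp_apply]
      rw [hc2]
      exact ENNReal.mul_ne_top (by simp) hcor)
  simp only [Function.comp_apply] at hb
  rw [hc2, hn2] at hb
  simp_rw [hcoef] at hb
  rw [ENNReal.tsum_mul_left] at hb
  set T := ∑' k : Fin d → ℤ, ‖∫ ω, Complex.exp (2 * Real.pi * Complex.I *
          ((inner ℝ (L⁻¹ • latticePoint k) ω : ℝ) : ℂ)) * F ω‖ₑ ^ 2
  have hkk : ENNReal.ofReal (L ^ d) * ENNReal.ofReal κ = 1 := by
    rw [← ENNReal.ofReal_mul (by positivity), hκ, mul_inv_cancel₀ (by positivity),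
      ENNReal.ofReal_one]
  set Λ := ENNReal.ofReal (L ^ d)
  set K := ENNReal.ofReal κ
  have hcancel : ∀ x : ℝ≥0∞, Λ ^ 2 * (K ^ 2 * x) = x := fun x => by
    rw [← mul_assoc, ← mul_pow, hkk, one_pow, one_mul]
  have hcancel1 : ∀ x : ℝ≥0∞, Λ ^ 2 * (K * x) = Λ * x := fun x => by
    calc _ = Λ * ((Λ * K) * x) := by ring
      _ = _ := by rw [hkk, one_mul]
  constructor
  -- The squared coefficients carry the Jacobian twice and the integrals once; multiplying by
  -- `L^(2d)` leaves a net factor `L^d` on the integrals.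
  · have := mul_le_mul_right hb.1 (Λ ^ 2)
    rwa [hcancel, ← mul_add, hcancel1] at this
  · have := mul_le_mul_right hb.2 (Λ ^ 2)
    rwa [mul_add, hcancel, hcancel1, hcancel1] at this

end Scaling

/-! ### Agreement of the `L²` and integral Fourier transforms. -/

section Plancherel

open SchwartzMap

variable {E : Type*} [NormedAddCommGroup E] [InnerProductSpace ℝ E] [FiniteDimensional ℝ E]
  [MeasurableSpace E] [BorelSpace E]

theorem continuous_fourier_of_integrable {g : E → ℂ} (h1 : Integrable g) : Continuous (𝓕 g) :=
  VectorFourier.fourierIntegral_continuous Real.continuous_fourierChar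
    (L := innerₗ E) continuous_inner h1

/-- On `L¹ ∩ L²` the `L²` Fourier transform is given by the Fourier integral. -/
theorem coeFn_fourier_toLp {g : E → ℂ} (h1 : Integrable g) (h2 : MemLp g 2 volume) :
    (𝓕 (h2.toLp g) : Lp ℂ 2 (volume : Measure E)) =ᵐ[volume] 𝓕 g := by
  -- Both sides are tested against smooth compactly supported functions. As tempered distributions,
  -- the `L²` transform moves onto the test function, and the multiplication formula moves it back
  -- onto `g`.
  refine ae_eq_of_integral_contDiff_smul_eq
    ((Lp.memLp (𝓕 (h2.toLp g) : Lp ℂ 2 (volume : Measure E))).locallyIntegrable (by norm_num))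
    (continuous_fourier_of_integrable h1).locallyIntegrable fun u hu hcu => ?_
  have hcu' : HasCompactSupport (fun x => (u x : ℂ)) := hcu.comp_left (g := Complex.ofReal) rfl
  set w : 𝓢(E, ℂ) := hcu'.toSchwartzMap (Complex.ofRealCLM.contDiff.comp hu) with hw
  have hwu : ∀ x, w x = (u x : ℂ) := fun x => rfl
  have h3 := DFunLike.congr_fun (Lp.fourier_toTemperedDistribution_eq (h2.toLp g)) w
  rw [TemperedDistribution.fourier_apply, Lp.toTemperedDistribution_apply,
    Lp.toTemperedDistribution_apply] at h3
  have h4 : ∫ x, (𝓕 w) x • (h2.toLp g) x = ∫ x, (𝓕 w) x • g x := by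
    refine integral_congr_ae ?_
    filter_upwards [h2.coeFn_toLp] with x hx
    rw [hx]
  have h5 : ∫ x, (𝓕 w) x • g x = ∫ x, w x • (𝓕 g) x := by
    have := VectorFourier.integral_fourierIntegral_smul_eq_flip (L := innerₗ E) (μ := volume)
      (ν := volume) Real.continuous_fourierChar continuous_inner w.integrable h1
    rw [flip_innerₗ] at this
    exact this
  rw [h4, h5] at h3
  simp only [hwu, smul_eq_mul] at h3
  simpa only [Complex.real_smul] using h3.symm

end Plancherel

/-! ### Fourier transforms of the atoms. -/

section Atoms

variable {d : ℕ} {φ : EuclideanSpace ℝ (Fin d) → ℂ}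

theorem continuous_Phi (hφ1 : Integrable φ) (μ : ℝ) (p : ℕ) (l : Fin d → ℤ) :
    Continuous (Phi φ μ p l) := by
  have := continuous_fourier_of_integrable hφ1
  unfold Phi
  fun_prop

theorem integrable_atom (hφ1 : Integrable φ) (μ ν : ℝ) (p : ℕ) (l k : Fin d → ℤ) :
    Integrable (atom φ μ ν p l k) := by
  unfold atom
  refine (integrable_finsetSum _ fun n _ => ?_).const_mul _
  refine (hφ1.comp_sub_right (shift ν p k)).bdd_mul (c := 1) ?_ ?_
  · exact Continuous.aestronglyMeasurable (by fun_prop)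
  · refine Filter.Eventually.of_forall fun x => ?_
    rw [Complex.norm_exp]
    simp

/-- Translation becomes a phase common to all summands, and each modulation by `μ n` shifts `φ̂`;
the shifted copies add up to `Phi`. -/
theorem fourier_atom (hφ1 : Integrable φ) (μ ν : ℝ) (p : ℕ) (l k : Fin d → ℤ)
    (ω : EuclideanSpace ℝ (Fin d)) :
    𝓕 (atom φ μ ν p l k) ω = (((beta p : ℝ) ^ (-(d : ℝ) / 2) : ℝ) : ℂ) *
      (Complex.exp (-(2 * Real.pi * Complex.I * ((inner ℝ (shift ν p k) ω : ℝ) : ℂ))) *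
        Phi φ μ p l ω) := by
  set s := shift ν p k with hs
  have h1 : 𝓕 (atom φ μ ν p l k) ω = ∫ v, ∑ n ∈ freqSet p l,
      (((beta p : ℝ) ^ (-(d : ℝ) / 2) : ℝ) : ℂ) *
      Complex.exp (-(2 * Real.pi * Complex.I * ((inner ℝ s ω : ℝ) : ℂ))) *
      (Complex.exp (↑(-2 * Real.pi * inner ℝ (v - s) (ω - μ • latticePoint n)) * Complex.I)
        • φ (v - s)) := by
    rw [Real.fourier_eq']
    refine integral_congr_ae (Filter.Eventually.of_forall fun v => ?_)
    simp only [atom, ← hs, smul_eq_mul]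
    rw [Finset.mul_sum, Finset.mul_sum]
    refine Finset.sum_congr rfl fun n _ => ?_
    have h2 : Complex.exp (↑(-2 * Real.pi * inner ℝ v ω) * Complex.I) *
        Complex.exp (2 * Real.pi * Complex.I * ((inner ℝ (μ • latticePoint n) (v - s) : ℝ) : ℂ))
        = Complex.exp (-(2 * Real.pi * Complex.I * ((inner ℝ s ω : ℝ) : ℂ))) *
          Complex.exp (↑(-2 * Real.pi * inner ℝ (v - s) (ω - μ • latticePoint n)) * Complex.I) := by
      rw [← Complex.exp_add, ← Complex.exp_add]
      congr 1
      rw [inner_sub_right (v - s), inner_sub_left v s ω, real_inner_comm (v - s)]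
      push_cast
      ring
    linear_combination (((beta p : ℝ) ^ (-(d : ℝ) / 2) : ℝ) : ℂ) * φ (v - s) * h2
  have hi : ∀ n : Fin d → ℤ, Integrable fun v =>
      Complex.exp (↑(-2 * Real.pi * inner ℝ v (ω - μ • latticePoint n)) * Complex.I) • φ v := by
    intro n
    simp only [smul_eq_mul]
    refine hφ1.bdd_mul (c := 1) (Continuous.aestronglyMeasurable (by fun_prop)) ?_
    exact Filter.Eventually.of_forall fun x => by rw [Complex.norm_exp]; simp
  rw [h1, integral_sub_right_eq_self (fun v => ∑ n ∈ freqSet p l,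
      (((beta p : ℝ) ^ (-(d : ℝ) / 2) : ℝ) : ℂ) *
      Complex.exp (-(2 * Real.pi * Complex.I * ((inner ℝ s ω : ℝ) : ℂ))) *
      (Complex.exp (↑(-2 * Real.pi * inner ℝ v (ω - μ • latticePoint n)) * Complex.I)
        • φ v)) s, integral_finsetSum _ fun n _ => (hi n).const_mul _]
  simp_rw [integral_const_mul]
  rw [Phi, Finset.mul_sum, Finset.mul_sum]
  refine Finset.sum_congr rfl fun n _ => ?_
  rw [Real.fourier_eq', mul_assoc]

theorem beta_pos (p : ℕ) : 0 < beta p := by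
  cases p <;> simp [beta]

/-- Up to a nonzero constant, `Phi` is the transform of the untranslated atom, so Plancherel
applies. -/
theorem memLp_Phi (hφ1 : Integrable φ) (hφ2 : MemLp φ 2 volume) (μ : ℝ) (p : ℕ)
    (l : Fin d → ℤ) : MemLp (Phi φ μ p l) 2 volume := by
  have h1 : MemLp (𝓕 (atom φ μ 0 p l 0)) 2 volume :=
    (memLp_congr_ae (coeFn_fourier_toLp (integrable_atom hφ1 μ 0 p l 0)
      (memLp_atom hφ2 μ 0 p l 0))).mp (Lp.memLp _)
  have hb : (0 : ℝ) < beta p := by exact_mod_cast beta_pos p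
  have hc : (((beta p : ℝ) ^ (-(d : ℝ) / 2) : ℝ) : ℂ) ≠ 0 := by
    exact_mod_cast (Real.rpow_pos_of_pos hb _).ne'
  have h2 : Phi φ μ p l = fun ω => (((beta p : ℝ) ^ (-(d : ℝ) / 2) : ℝ) : ℂ)⁻¹ *
      𝓕 (atom φ μ 0 p l 0) ω := by
    funext ω
    rw [fourier_atom hφ1, inv_mul_cancel_left₀ hc]
    simp [shift]
  rw [h2]
  exact h1.const_mul _

theorem inner_dostSystem (hφ1 : Integrable φ) (hφ2 : MemLp φ 2 volume) (μ ν : ℝ)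
    (q : BoxIndex d) (k : Fin d → ℤ)
    (f : Lp ℂ 2 (volume : Measure (EuclideanSpace ℝ (Fin d)))) :
    inner ℂ (dostSystem hφ2 μ ν (q, k)) f = (((beta q.1 : ℝ) ^ (-(d : ℝ) / 2) : ℝ) : ℂ) *
      ∫ ω, Complex.exp (2 * Real.pi * Complex.I * ((inner ℝ (shift ν q.1 k) ω : ℝ) : ℂ)) *
        (conj (Phi φ μ q.1 q.2 ω) * (𝓕 f : Lp ℂ 2 volume) ω) := by
  rw [← Lp.inner_fourier_eq, L2.inner_def, ← integral_const_mul]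
  refine integral_congr_ae ?_
  filter_upwards [coeFn_fourier_toLp (integrable_atom hφ1 μ ν q.1 q.2 k)
    (memLp_atom hφ2 μ ν q.1 q.2 k)] with ω hω
  simp only [dostSystem]
  rw [hω, fourier_atom hφ1, RCLike.inner_apply']
  simp only [map_mul, Complex.conj_ofReal, ← Complex.exp_conj, map_neg, Complex.conj_I,
    map_ofNat]
  rw [mul_neg, neg_mul, neg_neg]
  ring

end Atoms

/-! ### Decay of the off-diagonal correlations. -/

section Decay

variable {d : ℕ}

theorem norm_le_sum_abs (x : EuclideanSpace ℝ (Fin d)) : ‖x‖ ≤ ∑ i, |x i| := by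
  rw [EuclideanSpace.norm_eq]
  refine Real.sqrt_le_iff.mpr ⟨by positivity, ?_⟩
  simp only [Real.norm_eq_abs]
  exact Finset.sum_sq_le_sq_sum_of_nonneg fun i _ => abs_nonneg _

theorem norm_le_card_mul {x : EuclideanSpace ℝ (Fin d)} {r : ℝ} (h : ∀ i, |x i| ≤ r) :
    ‖x‖ ≤ d * r := by
  refine (norm_le_sum_abs x).trans ((Finset.sum_le_sum fun i _ => h i).trans ?_)
  simp

@[simp]
theorem latticePoint_apply (n : Fin d → ℤ) (i : Fin d) : latticePoint n i = n i := rfl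

theorem latticePoint_sub (m n : Fin d → ℤ) :
    latticePoint (m - n) = latticePoint m - latticePoint n := by
  ext i; simp

theorem one_le_norm_latticePoint {m : Fin d → ℤ} (hm : m ≠ 0) : 1 ≤ ‖latticePoint m‖ := by
  obtain ⟨i, hi⟩ := Function.ne_iff.mp hm
  refine le_trans ?_ (PiLp.norm_apply_le (latticePoint m) i)
  simp only [latticePoint_apply, Real.norm_eq_abs]
  exact_mod_cast Int.one_le_abs hi

theorem summable_norm_latticePoint_rpow {t : ℝ} (ht : (d : ℝ) < t) :
    Summable fun n : Fin d → ℤ => ‖latticePoint n‖ ^ (-t) := by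
  set b := (EuclideanSpace.basisFun (Fin d) ℝ).toBasis with hb
  set Λ := Submodule.span ℤ (Set.range b) with hΛ
  have hmem : ∀ n : Fin d → ℤ, latticePoint n ∈ Λ := by
    intro n
    have : latticePoint n = ∑ i, n i • b i := by
      ext j
      simp [hb, Finset.sum_apply, EuclideanSpace.basisFun_apply, Pi.single_apply]
    rw [this]
    exact Submodule.sum_mem _ fun i _ => Submodule.smul_mem _ _ (Submodule.subset_span ⟨i, rfl⟩)
  have h1 : Summable fun z : Λ => ‖z‖ ^ (-t) := by
    refine ZLattice.summable_norm_rpow Λ (-t) ?_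
    rw [ZLattice.rank ℝ Λ, finrank_euclideanSpace_fin]
    linarith
  exact h1.comp_injective (i := fun n : Fin d → ℤ => (⟨latticePoint n, hmem n⟩ : Λ))
    fun m n hmn => by
      ext i
      have h2 : latticePoint m = latticePoint n := congrArg Subtype.val hmn
      have h3 := congrArg (fun x : EuclideanSpace ℝ (Fin d) => x i) h2
      simpa using h3

theorem summable_one_add_norm_latticePoint_rpow {t μ : ℝ} (ht : (d : ℝ) < t) (hμ : 0 < μ) :
    Summable fun n : Fin d → ℤ => (1 + μ * ‖latticePoint n‖) ^ (-t) := by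
  have ht0 : 0 < t := (Nat.cast_nonneg d).trans_lt ht
  refine Summable.of_nonneg_of_le (fun n => by positivity) (fun n => ?_)
    (((summable_norm_latticePoint_rpow ht).mul_left (μ ^ (-t))).add
      (summable_of_hasFiniteSupport (f := fun n : Fin d → ℤ => if n = 0 then (1 : ℝ) else 0) ?_))
  · by_cases hn : n = 0
    · have h0 : 0 ≤ μ ^ (-t) * ‖latticePoint n‖ ^ (-t) := by positivity
      have h1 : (1 + μ * ‖latticePoint n‖) ^ (-t) ≤ 1 :=
        Real.rpow_le_one_of_one_le_of_nonpos (le_add_of_nonneg_right (by positivity)) (by linarith)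
      rw [if_pos hn]
      linarith
    · have h0 := one_le_norm_latticePoint hn
      rw [if_neg hn, add_zero, ← Real.mul_rpow hμ.le (norm_nonneg _)]
      exact Real.rpow_le_rpow_of_nonpos (by positivity) (by linarith) (by linarith)
  · refine (Set.finite_singleton (0 : Fin d → ℤ)).subset fun n hn => ?_
    by_contra h
    exact hn (if_neg h)

/-- Uniformity in `ω` comes from recentring at a lattice point within `d μ` of `ω`, at the price of
a factor `(1 + d μ)^t`. -/
theorem exists_sum_one_add_norm_sub_rpow_le {t μ : ℝ} (ht : (d : ℝ) < t) (hμ : 0 < μ) :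
    ∃ K : ℝ, 0 ≤ K ∧ ∀ (ω : EuclideanSpace ℝ (Fin d)) (s : Finset (Fin d → ℤ)),
      ∑ n ∈ s, (1 + ‖ω - μ • latticePoint n‖) ^ (-t) ≤ K := by
  have ht0 : 0 < t := (Nat.cast_nonneg d).trans_lt ht
  have hsum := summable_one_add_norm_latticePoint_rpow ht hμ
  refine ⟨(1 + d * μ) ^ t * ∑' n : Fin d → ℤ, (1 + μ * ‖latticePoint n‖) ^ (-t),
    mul_nonneg (by positivity) (tsum_nonneg fun n => by positivity), fun ω s => ?_⟩
  set n₀ : Fin d → ℤ := fun i => ⌊ω i / μ⌋ with hn₀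
  have h1 : ‖ω - μ • latticePoint n₀‖ ≤ d * μ := by
    refine norm_le_card_mul fun i => ?_
    simp only [PiLp.sub_apply, PiLp.smul_apply, latticePoint_apply, smul_eq_mul, hn₀]
    have h2 := Int.floor_le (ω i / μ)
    have h3 := Int.lt_floor_add_one (ω i / μ)
    rw [le_div_iff₀ hμ] at h2
    rw [div_lt_iff₀ hμ] at h3
    rw [abs_le]
    constructor <;> nlinarith
  have h2 : ∀ n, (1 + ‖ω - μ • latticePoint n‖) ^ (-t) ≤
      (1 + d * μ) ^ t * (1 + μ * ‖latticePoint (n - n₀)‖) ^ (-t) := by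
    intro n
    have h3 : μ * ‖latticePoint (n - n₀)‖ ≤ d * μ + ‖ω - μ • latticePoint n‖ := by
      rw [← abs_of_pos hμ, ← Real.norm_eq_abs, ← norm_smul, latticePoint_sub, smul_sub]
      rw [Real.norm_eq_abs, abs_of_pos hμ]
      calc _ = ‖(ω - μ • latticePoint n₀) - (ω - μ • latticePoint n)‖ := by congr 1; abel
        _ ≤ _ := (norm_sub_le _ _).trans (by linarith)
    have h4 : 1 + μ * ‖latticePoint (n - n₀)‖ ≤ (1 + d * μ) * (1 + ‖ω - μ • latticePoint n‖) := by
      have : 0 ≤ d * μ * ‖ω - μ • latticePoint n‖ := by positivity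
      linarith
    have h5 : (1 + ‖ω - μ • latticePoint n‖) ^ (-t) = (1 + d * μ) ^ t *
        ((1 + d * μ) * (1 + ‖ω - μ • latticePoint n‖)) ^ (-t) := by
      rw [Real.mul_rpow (by positivity) (by positivity), ← mul_assoc,
        ← Real.rpow_add (by positivity)]
      simp
    rw [h5]
    exact mul_le_mul_of_nonneg_left
      (Real.rpow_le_rpow_of_nonpos (by positivity) h4 (by linarith)) (by positivity)
  refine (Finset.sum_le_sum fun n _ => h2 n).trans ?_
  rw [← Finset.mul_sum]
  refine mul_le_mul_of_nonneg_left ?_ (by positivity)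
  have hs2 : Summable fun n : Fin d → ℤ => (1 + μ * ‖latticePoint (n - n₀)‖) ^ (-t) :=
    (Equiv.subRight n₀).summable_iff.mpr hsum
  refine (hs2.sum_le_tsum s fun n _ => by positivity).trans (le_of_eq ?_)
  exact (Equiv.subRight n₀).tsum_eq fun n : Fin d → ℤ => (1 + μ * ‖latticePoint n‖) ^ (-t)

theorem norm_latticePoint_sub_le {p : ℕ} {l m n : Fin d → ℤ} (hm : m ∈ freqSet p l)
    (hn : n ∈ freqSet p l) : ‖latticePoint m - latticePoint n‖ ≤ d * (beta p : ℝ) := by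
  refine norm_le_card_mul fun i => ?_
  simp only [freqSet, Fintype.mem_piFinset, Finset.mem_Ico] at hm hn
  have h1 := hm i
  have h2 := hn i
  have h3 : |m i - n i| ≤ (beta p : ℤ) := by
    rw [abs_le]
    constructor <;> nlinarith
  simp only [PiLp.sub_apply, latticePoint_apply]
  exact_mod_cast h3

variable {φ : EuclideanSpace ℝ (Fin d) → ℂ}

/-- Decay of the correlation of `Φ_{p;ℓ}` with its translates by nonzero points of the lattice
`(β(p)/ν) ℤ^d`. -/
theorem norm_Phi_mul_norm_Phi_add_le {μ C s K : ℝ} (hμ : 0 < μ) (hs : 0 < s)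
    (hdecay : ∀ ω : EuclideanSpace ℝ (Fin d), ‖𝓕 φ ω‖ ≤ C / (1 + ‖ω‖) ^ (2 * s))
    (hK : ∀ (ω : EuclideanSpace ℝ (Fin d)) (S : Finset (Fin d → ℤ)),
      ∑ n ∈ S, (1 + ‖ω - μ • latticePoint n‖) ^ (-s) ≤ K)
    {ν : ℝ} (hν : 0 < ν) (hν1 : 2 * (μ * d * ν) ≤ 1) (p : ℕ) (l : Fin d → ℤ) {m : Fin d → ℤ}
    (hm : m ≠ 0) (ω : EuclideanSpace ℝ (Fin d)) :
    ‖Phi φ μ p l ω‖ * ‖Phi φ μ p l (ω + (beta p / ν : ℝ) • latticePoint m)‖ ≤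
      C ^ 2 * K ^ 2 * (2 * ν) ^ s * ((beta p : ℝ) ^ (-s) * ‖latticePoint m‖ ^ (-s)) := by
  have hC : 0 ≤ C := by simpa using (norm_nonneg _).trans (hdecay 0)
  have hK0 : 0 ≤ K := by simpa using hK 0 ∅
  have hb : (0 : ℝ) < beta p := by exact_mod_cast beta_pos p
  have hm1 := one_le_norm_latticePoint hm
  set r := ‖latticePoint m‖ with hr
  set ω' := ω + (beta p / ν : ℝ) • latticePoint m with hω'
  -- Half the length of the translation: the other half absorbs the diameter of the frequency box.
  set ρ := beta p * r / (2 * ν) with hρ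
  have hρ0 : 0 < ρ := by positivity
  have hρs : ρ ^ (-s) = (2 * ν) ^ s * ((beta p : ℝ) ^ (-s) * r ^ (-s)) := by
    rw [hρ, Real.div_rpow (by positivity) (by positivity), Real.mul_rpow hb.le (by positivity),
      Real.rpow_neg (by positivity : 0 ≤ 2 * ν), div_inv_eq_mul, mul_comm]
  have hΦ : ∀ x, ‖Phi φ μ p l x‖ ≤ ∑ n ∈ freqSet p l,
      C * (1 + ‖x - μ • latticePoint n‖) ^ (-(2 * s)) := fun x => by
    refine (norm_sum_le _ _).trans (Finset.sum_le_sum fun n _ => (hdecay _).trans (le_of_eq ?_))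
    rw [Real.rpow_neg (by positivity), div_eq_mul_inv]
  have hpair : ∀ n ∈ freqSet p l, ∀ n' ∈ freqSet p l,
      (C * (1 + ‖ω - μ • latticePoint n‖) ^ (-(2 * s))) *
        (C * (1 + ‖ω' - μ • latticePoint n'‖) ^ (-(2 * s))) ≤
      C ^ 2 * ρ ^ (-s) * ((1 + ‖ω - μ • latticePoint n‖) ^ (-s) *
        (1 + ‖ω' - μ • latticePoint n'‖) ^ (-s)) := by
    intro n hn n' hn'
    set x := ‖ω - μ • latticePoint n‖ with hx
    set y := ‖ω' - μ • latticePoint n'‖ with hy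
    have hx0 : 0 ≤ x := norm_nonneg _
    have hy0 : 0 ≤ y := norm_nonneg _
    have h1 : beta p / ν * r ≤ x + y + μ * (d * beta p) := by
      have h2 : (beta p / ν : ℝ) • latticePoint m = (ω' - μ • latticePoint n')
          - (ω - μ • latticePoint n) - μ • (latticePoint n - latticePoint n') := by
        rw [hω', smul_sub]; abel
      have h3 : ‖(beta p / ν : ℝ) • latticePoint m‖ = beta p / ν * r := by
        rw [norm_smul, Real.norm_of_nonneg (by positivity)]
      have h4 : ‖μ • (latticePoint n - latticePoint n')‖ ≤ μ * (d * beta p) := by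
        rw [norm_smul, Real.norm_of_nonneg hμ.le]
        exact mul_le_mul_of_nonneg_left (norm_latticePoint_sub_le hn hn') hμ.le
      rw [← h3, h2]
      have h5 := norm_sub_le (ω' - μ • latticePoint n' - (ω - μ • latticePoint n))
        (μ • (latticePoint n - latticePoint n'))
      have h6 := norm_sub_le (ω' - μ • latticePoint n') (ω - μ • latticePoint n)
      linarith
    -- Smallness of `ν` enters here, together with `‖latticePoint m‖ ≥ 1`.
    have h2 : μ * (d * beta p) ≤ ρ := by
      rw [hρ, le_div_iff₀ (by positivity)]
      calc μ * (d * beta p) * (2 * ν) = beta p * (2 * (μ * d * ν)) := by ring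
        _ ≤ beta p * r := mul_le_mul_of_nonneg_left (hν1.trans hm1) hb.le
    have h3 : beta p / ν * r = 2 * ρ := by
      rw [hρ]; field_simp
    have h4 : ρ ≤ (1 + x) * (1 + y) := by nlinarith [mul_nonneg hx0 hy0]
    -- One half of the exponent is spent on the separation `ρ`; the other half stays for the sums
    -- over `n` and `n'`.
    have h5 : (1 + x) ^ (-(2 * s)) * (1 + y) ^ (-(2 * s)) =
        ((1 + x) * (1 + y)) ^ (-s) * ((1 + x) ^ (-s) * (1 + y) ^ (-s)) := by
      rw [Real.mul_rpow (by positivity) (by positivity), show -(2 * s) = -s + -s by ring,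
        Real.rpow_add (by positivity), Real.rpow_add (by positivity)]
      ring
    calc _ = C ^ 2 * ((1 + x) ^ (-(2 * s)) * (1 + y) ^ (-(2 * s))) := by ring
      _ = C ^ 2 * ((1 + x) * (1 + y)) ^ (-s) * ((1 + x) ^ (-s) * (1 + y) ^ (-s)) := by
        rw [h5]; ring
      _ ≤ _ := by
        refine mul_le_mul_of_nonneg_right (mul_le_mul_of_nonneg_left ?_ (by positivity))
          (by positivity)
        exact Real.rpow_le_rpow_of_nonpos hρ0 h4 (by linarith)
  calc _ ≤ (∑ n ∈ freqSet p l, C * (1 + ‖ω - μ • latticePoint n‖) ^ (-(2 * s))) *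
        (∑ n ∈ freqSet p l, C * (1 + ‖ω' - μ • latticePoint n‖) ^ (-(2 * s))) :=
        mul_le_mul (hΦ _) (hΦ _) (norm_nonneg _) (Finset.sum_nonneg fun n _ => by positivity)
    _ ≤ C ^ 2 * ρ ^ (-s) * ((∑ n ∈ freqSet p l, (1 + ‖ω - μ • latticePoint n‖) ^ (-s)) *
        (∑ n ∈ freqSet p l, (1 + ‖ω' - μ • latticePoint n‖) ^ (-s))) := by
        rw [Finset.sum_mul_sum, Finset.sum_mul_sum, Finset.mul_sum]
        refine Finset.sum_le_sum fun n hn => ?_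
        rw [Finset.mul_sum]
        exact Finset.sum_le_sum fun n' hn' => hpair n hn n' hn'
    _ ≤ C ^ 2 * ρ ^ (-s) * (K * K) := by
        refine mul_le_mul_of_nonneg_left ?_ (by positivity)
        exact mul_le_mul (hK _ _) (hK _ _) (Finset.sum_nonneg fun n _ => by positivity) hK0
    _ = _ := by rw [hρs]; ring

/-- The number of boxes per level is bounded independently of `p`, so a geometric series in `p`
dominates. -/
theorem tsum_beta_rpow_ne_top (d : ℕ) {s : ℝ} (hs : 1 ≤ s) :
    ∑' q : BoxIndex d, ENNReal.ofReal ((beta q.1 : ℝ) ^ (-s)) ≠ ⊤ := by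
  set I : Set (Fin d → ℤ) := Set.Icc (fun _ => -2) (fun _ => 1) with hI
  have hIf : I.Finite := Set.finite_Icc _ _
  have hbI : ∀ p, boxIndices d p ⊆ I := fun p l hl => by
    have h1 : ∀ s, -2 ≤ l s ∧ l s ≤ 1 := by
      cases p <;> exact hl.1
    exact ⟨fun s => (h1 s).1, fun s => (h1 s).2⟩
  have h1 : ∀ p, (beta p : ℝ) ^ (-s) ≤ 2 * (1 / 2) ^ p := by
    intro p
    have hb : (1 : ℝ) ≤ beta p := by exact_mod_cast beta_pos p
    refine (Real.rpow_le_rpow_of_exponent_le hb (by linarith : -s ≤ -1)).trans ?_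
    rw [Real.rpow_neg_one]
    cases p with
    | zero => norm_num [beta]
    | succ p => simp [beta, pow_succ]; linarith
  rw [ENNReal.tsum_sigma fun p (_ : boxIndices d p) => ENNReal.ofReal ((beta p : ℝ) ^ (-s))]
  refine ne_top_of_le_ne_top (b := ENNReal.ofReal (∑' p : ℕ, I.ncard * (2 * (1 / 2) ^ p)))
    ENNReal.ofReal_ne_top ?_
  have hsg : Summable fun p : ℕ => (I.ncard : ℝ) * (2 * (1 / 2) ^ p) :=
    (summable_geometric_two.mul_left 2).mul_left _
  rw [ENNReal.ofReal_tsum_of_nonneg (fun p => by positivity) hsg]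
  refine ENNReal.tsum_le_tsum fun p => ?_
  have := (hIf.subset (hbI p)).fintype
  rw [tsum_fintype, Finset.sum_const, nsmul_eq_mul, ENNReal.ofReal_mul (by positivity),
    ENNReal.ofReal_natCast]
  refine mul_le_mul' ?_ (ENNReal.ofReal_le_ofReal (h1 p))
  rw [Finset.card_univ, ← Nat.card_eq_fintype_card]
  exact_mod_cast Set.ncard_le_ncard (hbI p) hIf

/-- The total off-diagonal correlation is `O(ν^s)`, uniformly in the frequency. -/
theorem exists_tsum_correlation_le {μ C s : ℝ} (hμ : 0 < μ) (hd : 0 < d) (hs : (d : ℝ) < s)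
    (hdecay : ∀ ω : EuclideanSpace ℝ (Fin d), ‖𝓕 φ ω‖ ≤ C / (1 + ‖ω‖) ^ (2 * s)) :
    ∃ D : ℝ≥0∞, D ≠ ⊤ ∧ ∀ ν : ℝ, 0 < ν → 2 * (μ * d * ν) ≤ 1 →
      ∀ ω : EuclideanSpace ℝ (Fin d), ∑' q : BoxIndex d, ∑' m : Fin d → ℤ,
        (if m = 0 then 0 else ‖Phi φ μ q.1 q.2 ω‖ₑ *
          ‖Phi φ μ q.1 q.2 (ω + (beta q.1 / ν : ℝ) • latticePoint m)‖ₑ) ≤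
        ENNReal.ofReal (ν ^ s) * D := by
  have hd1 : (1 : ℝ) ≤ d := by exact_mod_cast hd
  obtain ⟨K, hK0, hK⟩ := exists_sum_one_add_norm_sub_rpow_le hs hμ
  set W := ∑' q : BoxIndex d, ENNReal.ofReal ((beta q.1 : ℝ) ^ (-s)) with hW
  set Z := ∑' m : Fin d → ℤ, ENNReal.ofReal (‖latticePoint m‖ ^ (-s)) with hZ
  have hZt : Z ≠ ⊤ := (summable_norm_latticePoint_rpow hs).tsum_ofReal_ne_top
  refine ⟨ENNReal.ofReal (C ^ 2 * K ^ 2 * 2 ^ s) * (W * Z), ENNReal.mul_ne_top (by simp)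
    (ENNReal.mul_ne_top (tsum_beta_rpow_ne_top d (hd1.trans hs.le)) hZt), fun ν hν hν1 ω => ?_⟩
  calc _ ≤ ∑' q : BoxIndex d, ∑' m : Fin d → ℤ,
        ENNReal.ofReal (ν ^ s) * ENNReal.ofReal (C ^ 2 * K ^ 2 * 2 ^ s) *
          (ENNReal.ofReal ((beta q.1 : ℝ) ^ (-s)) * ENNReal.ofReal (‖latticePoint m‖ ^ (-s))) := by
        refine ENNReal.tsum_le_tsum fun q => ENNReal.tsum_le_tsum fun m => ?_
        split_ifs with hm
        · exact zero_le
        rw [← ofReal_norm, ← ofReal_norm, ← ENNReal.ofReal_mul (norm_nonneg _),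
          ← ENNReal.ofReal_mul (by positivity), ← ENNReal.ofReal_mul (by positivity),
          ← ENNReal.ofReal_mul (by positivity)]
        refine ENNReal.ofReal_le_ofReal ((norm_Phi_mul_norm_Phi_add_le hμ (by linarith) hdecay hK
          hν hν1 q.1 q.2 hm ω).trans (le_of_eq ?_))
        rw [Real.mul_rpow (by norm_num) hν.le]
        ring
    _ = _ := by
        simp_rw [ENNReal.tsum_mul_left, ← hZ]
        rw [ENNReal.tsum_mul_right, ← hW, mul_assoc]

end Decay

/-! ### Frame bounds for one box and for the whole system. -/

section FrameBounds

variable {d : ℕ} {φ : EuclideanSpace ℝ (Fin d) → ℂ}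

theorem lintegral_enorm_sq_eq_norm_sq {α : Type*} [MeasurableSpace α] {ρ : Measure α}
    (f : Lp ℂ 2 ρ) : ∫⁻ x, ‖f x‖ₑ ^ 2 ∂ρ = ENNReal.ofReal (‖f‖ ^ 2) := by
  rw [ENNReal.ofReal_pow (norm_nonneg _), ofReal_norm, Lp.enorm_def,
    eLpNorm_eq_lintegral_rpow_enorm_toReal (by simp) (by simp), ← ENNReal.rpow_natCast,
    ← ENNReal.rpow_mul]
  simp

/-- Frame bounds for the translates belonging to a single box, up to the off-diagonal
correlations. -/
theorem tsum_enorm_inner_sq_bounds (hφ1 : Integrable φ) (hφ2 : MemLp φ 2 volume) (μ : ℝ) {ν : ℝ}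
    (hν : 0 < ν) (q : BoxIndex d) {b δ : ℝ≥0∞} (hb : b ≠ ⊤) (hδ : δ ≠ ⊤)
    (hΦ : ∀ ω, ‖Phi φ μ q.1 q.2 ω‖ₑ ^ 2 ≤ b)
    (hcor : ∀ ω, ∑' m : Fin d → ℤ, (if m = 0 then 0 else ‖Phi φ μ q.1 q.2 ω‖ₑ *
          ‖Phi φ μ q.1 q.2 (ω + (beta q.1 / ν : ℝ) • latticePoint m)‖ₑ) ≤ δ)
    (f : Lp ℂ 2 (volume : Measure (EuclideanSpace ℝ (Fin d)))) :
    ∑' k : Fin d → ℤ, ‖inner ℂ (dostSystem hφ2 μ ν (q, k)) f‖ₑ ^ 2 ≤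
      ENNReal.ofReal (ν ^ d)⁻¹ *
        ((∫⁻ ω, ‖(𝓕 f : Lp ℂ 2 volume) ω‖ₑ ^ 2 * ‖Phi φ μ q.1 q.2 ω‖ₑ ^ 2) +
        ∫⁻ ω, ‖(𝓕 f : Lp ℂ 2 volume) ω‖ₑ ^ 2 *
          ∑' m : Fin d → ℤ, (if m = 0 then 0 else ‖Phi φ μ q.1 q.2 ω‖ₑ *
          ‖Phi φ μ q.1 q.2 (ω + (beta q.1 / ν : ℝ) • latticePoint m)‖ₑ)) ∧
    ENNReal.ofReal (ν ^ d)⁻¹ *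
        ∫⁻ ω, ‖(𝓕 f : Lp ℂ 2 volume) ω‖ₑ ^ 2 * ‖Phi φ μ q.1 q.2 ω‖ₑ ^ 2 ≤
      ∑' k : Fin d → ℤ, ‖inner ℂ (dostSystem hφ2 μ ν (q, k)) f‖ₑ ^ 2 +
      ENNReal.ofReal (ν ^ d)⁻¹ * ∫⁻ ω, ‖(𝓕 f : Lp ℂ 2 volume) ω‖ₑ ^ 2 *
          ∑' m : Fin d → ℤ, (if m = 0 then 0 else ‖Phi φ μ q.1 q.2 ω‖ₑ *
          ‖Phi φ μ q.1 q.2 (ω + (beta q.1 / ν : ℝ) • latticePoint m)‖ₑ) := by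
  set u : EuclideanSpace ℝ (Fin d) → ℂ := ⇑(𝓕 f : Lp ℂ 2 volume) with hu
  set Ψ := Phi φ μ q.1 q.2 with hΨ
  have hum : Measurable u := (Lp.stronglyMeasurable _).measurable
  have hΨm : Measurable Ψ := (continuous_Phi hφ1 μ q.1 q.2).measurable
  have hβ : (0 : ℝ) < beta q.1 := by exact_mod_cast beta_pos q.1
  set L : ℝ := beta q.1 / ν with hL
  have hL0 : 0 < L := by positivity
  set F : EuclideanSpace ℝ (Fin d) → ℂ := fun ω => conj (Ψ ω) * u ω with hF
  have hFm : Measurable F := (continuous_star.measurable.comp hΨm).mul hum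
  have hFe : ∀ ω, ‖F ω‖ₑ = ‖u ω‖ₑ * ‖Ψ ω‖ₑ := fun ω => by
    rw [hF, enorm_mul, RCLike.enorm_conj, mul_comm]
  have hu2 : ∫⁻ ω, ‖u ω‖ₑ ^ 2 ≠ ⊤ := by
    rw [hu, lintegral_enorm_sq_eq_norm_sq]
    exact ENNReal.ofReal_ne_top
  have hFint : Integrable F :=
    (memLp_Phi hφ1 hφ2 μ q.1 q.2).star.integrable_mul (Lp.memLp _)
  have hFsq : ∫⁻ ω, ‖F ω‖ₑ ^ 2 = ∫⁻ ω, ‖u ω‖ₑ ^ 2 * ‖Ψ ω‖ₑ ^ 2 :=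
    lintegral_congr fun ω => by rw [hFe, mul_pow]
  have hF2 : ∫⁻ ω, ‖F ω‖ₑ ^ 2 ≠ ⊤ := by
    rw [hFsq]
    refine ne_top_of_le_ne_top (ENNReal.mul_ne_top hu2 hb) ?_
    rw [← lintegral_mul_const' _ _ hb]
    exact lintegral_mono fun ω => mul_le_mul_right (hΦ ω) _
  set R := ∫⁻ ω, ‖u ω‖ₑ ^ 2 * ∑' m : Fin d → ℤ, (if m = 0 then 0 else ‖Ψ ω‖ₑ *
          ‖Ψ (ω + L • latticePoint m)‖ₑ) with hR
  have hRt : R ≠ ⊤ := by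
    refine ne_top_of_le_ne_top (ENNReal.mul_ne_top hu2 hδ) ?_
    rw [← lintegral_mul_const' _ _ hδ]
    exact lintegral_mono fun ω => mul_le_mul_right (hcor ω) _
  let v : (Fin d → ℤ) →+ EuclideanSpace ℝ (Fin d) :=
    { toFun := fun m => L • latticePoint m
      map_zero' := by ext; simp
      map_add' := fun m n => by ext; simp [mul_add] }
  -- The Schur test with `h = |f̂|` and `ψ = |Φ|`.
  have hcorF : ∫⁻ ω, ∑' n : Fin d → ℤ,
      (if n = 0 then 0 else ‖F ω‖ₑ * ‖F (ω + L • latticePoint n)‖ₑ) ≤ R := by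
    simp_rw [hFe]
    exact lintegral_tsum_correlation_le hum.enorm hΨm.enorm v
  have hbd := tsum_enorm_sq_integral_exp_inner_bounds hL0 hFm hFint hF2
    (ne_top_of_le_ne_top hRt hcorF)
  set T := ∑' k : Fin d → ℤ, ‖∫ ω, Complex.exp (2 * Real.pi * Complex.I *
          ((inner ℝ (L⁻¹ • latticePoint k) ω : ℝ) : ℂ)) * F ω‖ₑ ^ 2 with hT
  have hinner : ∑' k : Fin d → ℤ, ‖inner ℂ (dostSystem hφ2 μ ν (q, k)) f‖ₑ ^ 2 =
      ENNReal.ofReal ((beta q.1 : ℝ) ^ d)⁻¹ * T := by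
    rw [hT, ← ENNReal.tsum_mul_left]
    refine tsum_congr fun k => ?_
    rw [inner_dostSystem hφ1, enorm_mul, mul_pow, hL, inv_div]
    congr 1
    rw [← ofReal_norm, ← ENNReal.ofReal_pow (norm_nonneg _), Complex.norm_real,
      Real.norm_of_nonneg (by positivity), ← Real.rpow_natCast, ← Real.rpow_mul hβ.le,
      ← Real.rpow_natCast, ← Real.rpow_neg hβ.le]
    congr 2
    push_cast
    ring
  -- The normalisation `β(p)^(-d/2)` of the atoms cancels the level dependence of `L^d`, so all
  -- boxes share the factor `ν^(-d)`.
  have hscale : ENNReal.ofReal ((beta q.1 : ℝ) ^ d)⁻¹ * ENNReal.ofReal (L ^ d) =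
      ENNReal.ofReal (ν ^ d)⁻¹ := by
    rw [← ENNReal.ofReal_mul (by positivity), hL, div_pow]
    congr 1
    field_simp
  rw [hinner, ← hFsq, ← hscale]
  constructor
  · rw [mul_assoc]
    exact mul_le_mul_right (hbd.1.trans (mul_le_mul_right (add_le_add_right hcorF _) _)) _
  · rw [mul_assoc, mul_assoc, ← mul_add]
    exact mul_le_mul_right (hbd.2.trans (add_le_add_right (mul_le_mul_right hcorF _) _)) _

/-- If the total off-diagonal correlation is at most `a / 2`, the DOST system is a frame. -/
theorem isFrameWithBounds_of_correlation_le (hφ1 : Integrable φ) (hφ2 : MemLp φ 2 volume) (μ : ℝ)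
    {ν a b : ℝ} (hν : 0 < ν) (ha : 0 < a) (hb : 0 < b)
    (hab : ∀ ω : EuclideanSpace ℝ (Fin d),
      a ≤ ∑' q : BoxIndex d, ‖Phi φ μ q.1 q.2 ω‖ ^ 2 ∧
      ∑' q : BoxIndex d, ‖Phi φ μ q.1 q.2 ω‖ ^ 2 ≤ b)
    (hcor : ∀ ω : EuclideanSpace ℝ (Fin d), ∑' q : BoxIndex d, ∑' m : Fin d → ℤ,
        (if m = 0 then 0 else ‖Phi φ μ q.1 q.2 ω‖ₑ *
          ‖Phi φ μ q.1 q.2 (ω + (beta q.1 / ν : ℝ) • latticePoint m)‖ₑ) ≤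
        ENNReal.ofReal (a / 2)) :
    IsFrameWithBounds ((ν ^ d)⁻¹ * (a / 2)) ((ν ^ d)⁻¹ * (b + a / 2)) (dostSystem hφ2 μ ν) := by
  refine ⟨by positivity, by positivity, fun f => ?_⟩
  set u : EuclideanSpace ℝ (Fin d) → ℂ := ⇑(𝓕 f : Lp ℂ 2 volume) with hu
  have hum : Measurable u := (Lp.stronglyMeasurable _).measurable
  have hΨm : ∀ q : BoxIndex d, Measurable (Phi φ μ q.1 q.2) := fun q =>
    (continuous_Phi hφ1 μ q.1 q.2).measurable
  set R : BoxIndex d → EuclideanSpace ℝ (Fin d) → ℝ≥0∞ := fun q ω => ∑' m : Fin d → ℤ,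
    (if m = 0 then 0 else ‖Phi φ μ q.1 q.2 ω‖ₑ *
      ‖Phi φ μ q.1 q.2 (ω + (beta q.1 / ν : ℝ) • latticePoint m)‖ₑ) with hR
  have hRm : ∀ q, Measurable (R q) := fun q => Measurable.tsum fun m => by
    split_ifs
    · exact measurable_const
    · exact (hΨm q).enorm.mul ((hΨm q).comp (measurable_add_const _)).enorm
  have hsum : ∀ ω, ∑' q : BoxIndex d, ‖Phi φ μ q.1 q.2 ω‖ₑ ^ 2 =
      ENNReal.ofReal (∑' q : BoxIndex d, ‖Phi φ μ q.1 q.2 ω‖ ^ 2) := by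
    intro ω
    have hs : Summable fun q : BoxIndex d => ‖Phi φ μ q.1 q.2 ω‖ ^ 2 := by
      -- A divergent real `tsum` has the value `0`, which the lower bound `a > 0` excludes.
      by_contra h
      have := (hab ω).1
      rw [tsum_eq_zero_of_not_summable h] at this
      linarith
    rw [ENNReal.ofReal_tsum_of_nonneg (fun _ => by positivity) hs]
    exact tsum_congr fun q => by rw [ENNReal.ofReal_pow (norm_nonneg _), ofReal_norm]
  have hb1 : ∀ ω, ∑' q : BoxIndex d, ‖Phi φ μ q.1 q.2 ω‖ₑ ^ 2 ≤ ENNReal.ofReal b := fun ω => by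
    rw [hsum]
    exact ENNReal.ofReal_le_ofReal (hab ω).2
  have ha1 : ∀ ω, ENNReal.ofReal a ≤ ∑' q : BoxIndex d, ‖Phi φ μ q.1 q.2 ω‖ₑ ^ 2 := fun ω => by
    rw [hsum]
    exact ENNReal.ofReal_le_ofReal (hab ω).1
  have hlevel := fun q => tsum_enorm_inner_sq_bounds hφ1 hφ2 μ hν q (b := ENNReal.ofReal b)
    (δ := ENNReal.ofReal (a / 2)) ENNReal.ofReal_ne_top ENNReal.ofReal_ne_top
    (fun ω => (ENNReal.le_tsum q).trans (hb1 ω))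
    (fun ω => (ENNReal.le_tsum (f := fun q => R q ω) q).trans (hcor ω)) f
  set κ := ENNReal.ofReal (ν ^ d)⁻¹ with hκ
  set T : ℝ≥0∞ := ∑' γ, ‖inner ℂ (dostSystem hφ2 μ ν γ) f‖ₑ ^ 2 with hT
  have hTq : T = ∑' q, ∑' k, ‖inner ℂ (dostSystem hφ2 μ ν (q, k)) f‖ₑ ^ 2 :=
    ENNReal.tsum_prod (f := fun q k => ‖inner ℂ (dostSystem hφ2 μ ν (q, k)) f‖ₑ ^ 2)
  set M := ∫⁻ ω, ‖u ω‖ₑ ^ 2 * ∑' q : BoxIndex d, ‖Phi φ μ q.1 q.2 ω‖ₑ ^ 2 with hM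
  set Q := ∫⁻ ω, ‖u ω‖ₑ ^ 2 * ∑' q : BoxIndex d, R q ω with hQ
  have htsum : ∀ g : BoxIndex d → EuclideanSpace ℝ (Fin d) → ℝ≥0∞, (∀ q, Measurable (g q)) →
      ∫⁻ ω, ‖u ω‖ₑ ^ 2 * ∑' q, g q ω = ∑' q, ∫⁻ ω, ‖u ω‖ₑ ^ 2 * g q ω := by
    intro g hg
    rw [← lintegral_tsum (f := fun q ω => ‖u ω‖ₑ ^ 2 * g q ω) fun q =>
      ((hum.enorm.pow_const 2).mul (hg q)).aemeasurable]
    simp_rw [ENNReal.tsum_mul_left]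
  have hMq : M = ∑' q : BoxIndex d, ∫⁻ ω, ‖u ω‖ₑ ^ 2 * ‖Phi φ μ q.1 q.2 ω‖ₑ ^ 2 :=
    htsum (fun q ω => ‖Phi φ μ q.1 q.2 ω‖ₑ ^ 2) fun q => (hΨm q).enorm.pow_const 2
  have hQq : Q = ∑' q : BoxIndex d, ∫⁻ ω, ‖u ω‖ₑ ^ 2 * R q ω := htsum R hRm
  have hup : T ≤ κ * (M + Q) := by
    rw [hTq, hMq, hQq, ← ENNReal.tsum_add, ← ENNReal.tsum_mul_left]
    exact ENNReal.tsum_le_tsum fun q => (hlevel q).1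
  have hlow : κ * M ≤ T + κ * Q := by
    rw [hTq, hMq, hQq, ← ENNReal.tsum_mul_left, ← ENNReal.tsum_mul_left, ← ENNReal.tsum_add]
    exact ENNReal.tsum_le_tsum fun q => (hlevel q).2
  have hnorm : ∫⁻ ω, ‖u ω‖ₑ ^ 2 = ENNReal.ofReal (‖f‖ ^ 2) := by
    rw [hu, lintegral_enorm_sq_eq_norm_sq, Lp.norm_fourier_eq]
  have hMb : M ≤ ENNReal.ofReal (‖f‖ ^ 2 * b) := by
    rw [ENNReal.ofReal_mul (by positivity), ← hnorm,
      ← lintegral_mul_const' _ _ ENNReal.ofReal_ne_top]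
    exact lintegral_mono fun ω => mul_le_mul_right (hb1 ω) _
  have hMa : ENNReal.ofReal (‖f‖ ^ 2 * a) ≤ M := by
    rw [ENNReal.ofReal_mul (by positivity), ← hnorm,
      ← lintegral_mul_const' _ _ ENNReal.ofReal_ne_top]
    exact lintegral_mono fun ω => mul_le_mul_right (ha1 ω) _
  have hQb : Q ≤ ENNReal.ofReal (‖f‖ ^ 2 * (a / 2)) := by
    rw [ENNReal.ofReal_mul (by positivity), ← hnorm,
      ← lintegral_mul_const' _ _ ENNReal.ofReal_ne_top]
    exact lintegral_mono fun ω => mul_le_mul_right (hcor ω) _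
  have hν' : 0 < (ν ^ d)⁻¹ := by positivity
  have hTup : T ≤ ENNReal.ofReal ((ν ^ d)⁻¹ * (b + a / 2) * ‖f‖ ^ 2) := by
    refine hup.trans ((mul_le_mul_right (add_le_add hMb hQb) _).trans (le_of_eq ?_))
    rw [← ENNReal.ofReal_add (by positivity) (by positivity), hκ,
      ← ENNReal.ofReal_mul (by positivity)]
    congr 1
    ring
  have hTlow : ENNReal.ofReal ((ν ^ d)⁻¹ * (‖f‖ ^ 2 * a)) ≤
      T + ENNReal.ofReal ((ν ^ d)⁻¹ * (‖f‖ ^ 2 * (a / 2))) := by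
    rw [ENNReal.ofReal_mul hν'.le, ENNReal.ofReal_mul hν'.le]
    exact (mul_le_mul_right hMa _).trans (hlow.trans
      (add_le_add_right (mul_le_mul_right hQb _) _))
  -- Finiteness permits the return to real numbers, where the error `a/2` can be subtracted from
  -- `a`.
  have hTt : T ≠ ⊤ := ne_top_of_le_ne_top ENNReal.ofReal_ne_top hTup
  have hterm : ∀ γ, (‖inner ℂ (dostSystem hφ2 μ ν γ) f‖ₑ ^ 2).toReal =
      ‖inner ℂ (dostSystem hφ2 μ ν γ) f‖ ^ 2 := fun γ => by simp
  have hsumm : Summable fun γ => ‖inner ℂ (dostSystem hφ2 μ ν γ) f‖ ^ 2 := by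
    simpa only [hterm] using ENNReal.summable_toReal hTt
  have hTeq : T.toReal = ∑' γ, ‖inner ℂ (dostSystem hφ2 μ ν γ) f‖ ^ 2 := by
    rw [hT, ENNReal.tsum_toReal_eq fun γ => by simp]
    exact tsum_congr hterm
  refine ⟨hsumm, ?_, ?_⟩
  · rw [← hTeq]
    rw [← ENNReal.ofReal_toReal hTt, ← ENNReal.ofReal_add (by positivity) (by positivity),
      ENNReal.ofReal_le_ofReal_iff (by positivity)] at hTlow
    linarith
  · rw [← hTeq]
    exact ENNReal.toReal_le_of_le_ofReal (by positivity) hTup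

end FrameBounds

end DOST

/-! ### Choice of `ν₀` and conclusion. -/

theorem theoremT (d : ℕ) (hd : 0 < d) (φ : EuclideanSpace ℝ (Fin d) → ℂ)
    (hφ1 : MemLp φ 1 volume) (hφ2 : MemLp φ 2 volume)
    (μ : ℝ) (hμ : 0 < μ) (a b : ℝ) (ha : 0 < a) (hb : 0 < b)
    (hab : ∀ ω : EuclideanSpace ℝ (Fin d),
      a ≤ ∑' q : DOST.BoxIndex d, ‖DOST.Phi φ μ q.1 q.2 ω‖ ^ 2 ∧
      ∑' q : DOST.BoxIndex d, ‖DOST.Phi φ μ q.1 q.2 ω‖ ^ 2 ≤ b)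
    (N : ℝ) (hN : 2 * (d : ℝ) < N) (C : ℝ)
    (hdecay : ∀ ω : EuclideanSpace ℝ (Fin d), ‖𝓕 φ ω‖ ≤ C / (1 + ‖ω‖) ^ N) :
    ∃ ν₀ : ℝ, 0 < ν₀ ∧ ∀ ν : ℝ, 0 < ν → ν < ν₀ →
      ∃ A B : ℝ, DOST.IsFrameWithBounds A B (DOST.dostSystem hφ2 μ ν) ∧
        ∀ f : Lp ℂ 2 (volume : Measure (EuclideanSpace ℝ (Fin d))),
          ∃ Sf : Lp ℂ 2 (volume : Measure (EuclideanSpace ℝ (Fin d))),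
            HasSum (fun γ => inner ℂ (DOST.dostSystem hφ2 μ ν γ) f • DOST.dostSystem hφ2 μ ν γ) Sf ∧
            A * ‖f‖ ^ 2 ≤ ‖inner ℂ f Sf‖ ∧ ‖inner ℂ f Sf‖ ≤ B * ‖f‖ ^ 2 := by
  have hφi : Integrable φ := memLp_one_iff_integrable.mp hφ1
  obtain ⟨D, hD, hDle⟩ := DOST.exists_tsum_correlation_le (φ := φ) (s := N / 2) hμ hd
    (by linarith) (by simpa only [mul_div_cancel₀ N (two_ne_zero (α := ℝ))] using hdecay)
  have hd1 : (1 : ℝ) ≤ d := by exact_mod_cast hd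
  have hD0 : 0 ≤ D.toReal := ENNReal.toReal_nonneg
  -- The three bounds give, in turn, `ν^(N/2) ≤ ν` (as `N/2 ≥ 1`), the separation condition `2 μ d ν
  -- ≤ 1`, and `ν D ≤ a/2`; the `+ 1` avoids division by zero.
  refine ⟨min 1 (min (1 / (2 * (μ * d))) (a / (2 * (D.toReal + 1)))), by positivity,
    fun ν hν hν0 => ?_⟩
  simp only [lt_min_iff] at hν0
  obtain ⟨h1, h2, h3⟩ := hν0
  rw [lt_div_iff₀ (by positivity)] at h2 h3
  have hcor : ENNReal.ofReal (ν ^ (N / 2)) * D ≤ ENNReal.ofReal (a / 2) := by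
    rw [← ENNReal.ofReal_toReal hD, ← ENNReal.ofReal_mul (by positivity)]
    refine ENNReal.ofReal_le_ofReal ?_
    have h4 : ν ^ (N / 2) ≤ ν := by
      simpa using Real.rpow_le_rpow_of_exponent_ge hν h1.le (by linarith : (1 : ℝ) ≤ N / 2)
    have h5 := mul_le_mul_of_nonneg_right h4 hD0
    linarith
  have hframe := DOST.isFrameWithBounds_of_correlation_le hφi hφ2 μ hν ha hb hab
    fun ω => (hDle ν hν (by linarith) ω).trans hcor
  refine ⟨_, _, hframe, fun f => ?_⟩
  obtain ⟨-, hB, hbd⟩ := hframe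
  obtain ⟨Sf, hSf, hin⟩ := DOST.exists_hasSum_frameOperator hB
    (fun f => ⟨(hbd f).1, (hbd f).2.2⟩) f
  refine ⟨Sf, hSf, ?_⟩
  rw [hin, Complex.norm_real, Real.norm_of_nonneg (tsum_nonneg fun _ => by positivity)]
  exact (hbd f).2
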